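/- **Setting.** Let $K$ be a field, $R=K[x_1,\dots,x_n]$, $\mathcal M$ the monoid of monomials, $\mathcal M_d=\{\mu\mathbf e_i:\mu\in\mathcal M,\ 1\le i\le d\}\subset R^d$. Let $\le_m$ be an admissible monomial order on $\mathcal M$ (linear, multiplicative, with least element $1$), and $\le_s$ an admissible module order on $\mathcal M_d$: a linear order with $\mathbf e_i\le_s\mu\mathbf e_i$, and $\sigma\mathbf e_i\le_s\tau\mathbf e_j\Rightarrow\mu\sigma\mathbf e_i\le_s\mu\tau\mathbf e_j$. Assume the orders are compatible: $\sigma\mathbf e_i\le_s\tau\mathbf e_i\iff\sigma\le_m\tau$. For $sp=(\mathbf u,p)\in R^d\times R$ the signature is $lm(\mathbf u)$ (w.r.t. $\le_s$), its index is the $i$ with $lm(\mathbf u)=\mu\mathbf e_i$, and $LM(sp)=(lm(\mathbf u),lm(p))$ with $lm(0)=0$ smaller than all monomials; $sp$ is called a syzygy if $p=0$. * $(\mathbf u',p')$ *ts-rewrites* $(\mathbf u,p)$, $p\ne0$, if for some $\lambda\in\mathcal M$, $\lambda\, lm(\mathbf u')=lm(\mathbf u)$ and $\lambda\, lm(p')<_m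 lm(p)$ (the latter being automatic if $p'=0$). * $(\mathbf u',p')$ *tm-reduces* $(\mathbf u,p)$, $p,p'\ne0$, if for some $\lambda\in\mathcal M$, $\lambda\, lm(p')=lm(p)$ and $\lambda\, lm(\mathbf u')<_s lm(\mathbf u)$; the result is $(\mathbf u,p)-\frac{lc(p)}{lc(p')}\lambda(\mathbf u',p')$. * $(\mu\mathbf e_i,m)\preceq_l(\mu'\mathbf e_j,m')$ iff $i=j$ and $m\mu'\le_m m'\mu$. * For non-syzygies $sp_1,sp_2$ with polynomial parts $p_1,p_2$ let $m_k=\mathrm{lcm}(lm(p_1),lm(p_2))/lm(p_k)$. If the signature of $m_1sp_1$ is $>_s$ that of $m_2sp_2$, the *J-pair* of $sp_1,sp_2$ is $m_1sp_1$, with first component $sp_1$; symmetrically if it is $<_s$. If the two signatures are equal there is no J-pair. * A J-pair $m\,sp_k$ is *F5-rewritable* by a list $\mathcal{SG}'$ containing $sp_k$ if the last element of $\mathcal{SG}'$ whose signature divides that of $m\,sp_k$ is not $sp_k$. **The F5G algorithm** on input $\mathbf F=(f_1,\dots,f_d)$. Interreduce $\mathbf F$: repeatedly delete zeros and cancel a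 term of one element by a multiple of another nonzero element whose leading monomial divides the term, until neither is possible (elements may finally be multiplied by nonzero constants). Sort by ascending leading monomials, giving $f_1,\dots,f_{d'}$, $d'\le d$. Put $F_i=(\mathbf e_i,f_i)$, $\mathcal{SG}'=[F_1,\dots,F_{d'}]$, let $\mathbf{CPs}$ be the set of all J-pairs of $F_i,F_j$, $i<j$, and $\mathbf{PSyz}=\{(f_i\mathbf e_j-f_j\mathbf e_i,0):i<j\}$. While $\mathbf{CPs}\neq\emptyset$: remove from $\mathbf{CPs}$ an element $cp$ of minimal signature. *Criteria*: if $cp$ is ts-rewritable by an element of $\mathbf{PSyz}$ or F5-rewritable by $\mathcal{SG}'$, do nothing more with it. Otherwise tm-reduce $cp$ by elements of $\mathcal{SG}'$ until no tm-reduction is possible, obtaining $sp=(\mathbf u,g)$. Insert $sp$ into $\mathcal{SG}'$ right after the last element whose leading pair is $\succeq_l LM(sp)$ or, if there is none, before the first element with the same index as $sp$. If $g\ne0$: add to $\mathbf{CPs}$ the J-pairs of $sp$ with all other non-syzygies of $\mathcal{SG}'$ and keep for each signature only the J-pair whose first component comes last in $\mathcal{SG}'$; add to $\mathbf{PSyz}$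 the nonzero principal syzygies $(g\mathbf u_l-g_l\mathbf u,0)$ for all non-syzygies $(\mathbf u_l,g_l)\in\mathcal{SG}'$, and discard from $\mathbf{PSyz}$ elements whose signature is divisible by that of another one that is kept, until no signature in $\mathbf{PSyz}$ divides that of another element. At the end return $\{g:(\mathbf u,g)\in\mathcal{SG}',\ g\ne0\}$. **Theorem.** For every finite family $\mathbf F=(f_1,\dots,f_d)$ in $R$, and whatever choices are made where the algorithm leaves them open, 1. the F5G algorithm terminates after finitely many steps (interreduction and tm-reduction steps included); 2. it ends only by returning its output, and that output is a Gröbner basis of $\mathcal I=\langle\mathbf F\rangle$ with respect to $\le_m$; 3. whenever $cp$ is chosen from $\mathbf{CPs}$, it passes the criteria if and only if it is not ts-rewritable by $\mathbf{PSyz}\cup\mathcal{SG}'$, with the values of $\mathbf{PSyz}$ and $\mathcal{SG}'$ at that moment. -/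

import Mathlib

open MvPolynomial

noncomputable section

namespace F5G

/-! ### Module monomials and module orders -/

/-- A module monomial `x^mon · e_idx` of the free module `R^d`, where `R = K[x_1, …, x_n]`.
Monomials of `R` are written additively, through their exponent vectors. -/
@[ext]
structure ModMon (n d : ℕ) where
  mon : Fin n →₀ ℕ
  idx : Fin d

/-- The multiple `x^a · s` of a module monomial `s`. -/
def ModMon.shift {n d : ℕ} (a : Fin n →₀ ℕ) (s : ModMon n d) : ModMon n d :=
  ⟨a + s.mon, s.idx⟩

/-- Divisibility of module monomials: `s ∣ t` iff `t = x^a · s` for some monomial `x^a`. -/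
def ModMon.Divides {n d : ℕ} (s t : ModMon n d) : Prop :=
  ∃ a : Fin n →₀ ℕ, s.shift a = t

/-- An admissible module order: a linear order on module monomials with `e_i ≤ x^a e_i` which is
stable under multiplication by monomials. -/
structure ModuleOrder (n d : ℕ) where
  toLinearOrder : LinearOrder (ModMon n d)
  unit_le : ∀ (a : Fin n →₀ ℕ) (i : Fin d), toLinearOrder.le ⟨0, i⟩ ⟨a, i⟩
  shift_le : ∀ (a : Fin n →₀ ℕ) (s t : ModMon n d),
    toLinearOrder.le s t → toLinearOrder.le (s.shift a) (t.shift a)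

namespace ModuleOrder

variable {n d : ℕ}

def le (o : ModuleOrder n d) (s t : ModMon n d) : Prop := o.toLinearOrder.le s t

def lt (o : ModuleOrder n d) (s t : ModMon n d) : Prop := o.toLinearOrder.lt s t

/-- The module order is compatible with the monomial order `m`:
`x^a e_i ≤ x^b e_i` iff `x^a ≤ x^b`. -/
def Compatible (o : ModuleOrder n d) (m : MonomialOrder (Fin n)) : Prop :=
  ∀ (a b : Fin n →₀ ℕ) (i : Fin d), o.le ⟨a, i⟩ ⟨b, i⟩ ↔ m.toSyn a ≤ m.toSyn b

open scoped Classical in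
/-- The leading module monomial of a vector of polynomials (`⊥` for the zero vector). -/
def leadMon {K : Type*} [Field K] (o : ModuleOrder n d)
    (u : Fin d → MvPolynomial (Fin n) K) : WithBot (ModMon n d) :=
  letI := o.toLinearOrder
  (Finset.univ.biUnion fun i => (u i).support.image fun a => (⟨a, i⟩ : ModMon n d)).max

end ModuleOrder

/-! ### Sig-polynomials -/

/-- A pair `(u, p)` in `R^d × R`. -/
@[ext]
structure SigPoly (K : Type*) [Field K] (n d : ℕ) where
  vec : Fin d → MvPolynomial (Fin n) K
  poly : MvPolynomial (Fin n) K

/-- A J-pair `x^mult · fst`, stored as its multiplier and its first component. -/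
@[ext]
structure JPair (K : Type*) [Field K] (n d : ℕ) where
  mult : Fin n →₀ ℕ
  fst : SigPoly K n d

section

variable {K : Type*} [Field K] {n d : ℕ}

/-- The term multiple `c x^a · (u, p)`. -/
def SigPoly.termMul (a : Fin n →₀ ℕ) (c : K) (x : SigPoly K n d) : SigPoly K n d :=
  ⟨fun i => monomial a c * x.vec i, monomial a c * x.poly⟩

/-- The sig-polynomial `x^mult · fst` that a J-pair stands for. -/
def JPair.toSigPoly (cp : JPair K n d) : SigPoly K n d := cp.fst.termMul cp.mult 1

variable (m : MonomialOrder (Fin n)) (o : ModuleOrder n d)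

/-- The signature `lm(u)` of `(u, p)`. -/
def sig (x : SigPoly K n d) : WithBot (ModMon n d) := o.leadMon x.vec

/-- The signature of `x` divides the signature of `y`. -/
def SigDivides (x y : SigPoly K n d) : Prop :=
  ∃ s t : ModMon n d, sig o x = s ∧ sig o y = t ∧ s.Divides t

/-- `x` ts-rewrites `y`: `y` is not a syzygy, and either `x` is a syzygy whose signature divides
that of `y`, or `x^a · sig(x) = sig(y)` and `x^a · lm(x) < lm(y)` for some monomial `x^a`.
(As `withBotDegree 0 = ⊥`, both cases are covered by one inequality.) -/
def TsRewrites (x y : SigPoly K n d) : Prop :=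
  y.poly ≠ 0 ∧ ∃ (s t : ModMon n d) (a : Fin n →₀ ℕ), sig o x = s ∧ sig o y = t ∧
    s.shift a = t ∧
    m.toWithBotSyn (a + m.withBotDegree x.poly) < m.toWithBotSyn (m.withBotDegree y.poly)

/-- `y` is ts-rewritable by the set `B`. -/
def TsRewritable (B : Set (SigPoly K n d)) (y : SigPoly K n d) : Prop :=
  ∃ x ∈ B, TsRewrites m o x y

/-- One tm-reduction step of `y` to `z` by `x`: both polynomial parts are nonzero,
`x^a · lm(x) = lm(y)`, `x^a · sig(x) < sig(y)`, and `z` is obtained from `y` by cancelling the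
leading term of its polynomial part with a multiple of `x`. -/
def TmReducesBy (x y z : SigPoly K n d) : Prop :=
  x.poly ≠ 0 ∧ y.poly ≠ 0 ∧ ∃ (s t : ModMon n d) (a : Fin n →₀ ℕ),
    sig o x = s ∧ sig o y = t ∧
    a + m.degree x.poly = m.degree y.poly ∧ o.lt (s.shift a) t ∧
    z.vec = y.vec - (x.termMul a (m.leadingCoeff y.poly / m.leadingCoeff x.poly)).vec ∧
    z.poly = y.poly - (x.termMul a (m.leadingCoeff y.poly / m.leadingCoeff x.poly)).poly

/-- One tm-reduction step of `y` to `z` by some element of the list `SG`. -/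
def TmReduces (SG : List (SigPoly K n d)) (y z : SigPoly K n d) : Prop :=
  ∃ x ∈ SG, TmReducesBy m o x y z

/-- The order `⪯_l` between leading pairs: `(μ e_i, a) ⪯_l (μ' e_i, a')` iff `a μ' ≤ a' μ`;
leading pairs whose signatures have different indices are not comparable. A syzygy has leading
monomial `0`, encoded by `⊥`. -/
def LeL (x y : SigPoly K n d) : Prop :=
  ∃ s t : ModMon n d, sig o x = s ∧ sig o y = t ∧ s.idx = t.idx ∧
    m.toWithBotSyn (m.withBotDegree x.poly + t.mon) ≤
      m.toWithBotSyn (m.withBotDegree y.poly + s.mon)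

/-- The signatures of `x` and `y` have the same index. -/
def SameIdx (x y : SigPoly K n d) : Prop :=
  ∃ s t : ModMon n d, sig o x = s ∧ sig o y = t ∧ s.idx = t.idx

open scoped Classical in
/-- The J-pair of `x` and `y` with first component `x`, if there is one (as a set with at most one
element): with `l = lcm(lm(x), lm(y))`, `a = l / lm(x)`, `b = l / lm(y)`, it is `x^a · x`, provided
that `x^a · sig(x) > x^b · sig(y)`. -/
def jPairFst (x y : SigPoly K n d) : Finset (JPair K n d) :=
  if x.poly ≠ 0 ∧ y.poly ≠ 0 ∧ ∃ s t : ModMon n d, sig o x = s ∧ sig o y = t ∧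
      o.lt (t.shift ((m.degree x.poly ⊔ m.degree y.poly) - m.degree y.poly))
        (s.shift ((m.degree x.poly ⊔ m.degree y.poly) - m.degree x.poly)) then
    {⟨(m.degree x.poly ⊔ m.degree y.poly) - m.degree x.poly, x⟩}
  else ∅

open scoped Classical in
/-- The J-pair of `x` and `y`, whichever of them is its first component. -/
def jPair (x y : SigPoly K n d) : Finset (JPair K n d) :=
  jPairFst m o x y ∪ jPairFst m o y x

/-! ### The subroutines -/

open scoped Classical in
/-- The F5-rewritable check: the last element of `SG` whose signature divides that of `cp` is not
the first component of `cp`. -/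
def F5Rewritable (SG : List (SigPoly K n d)) (cp : JPair K n d) : Prop :=
  match SG.reverse.find? (fun x => decide (SigDivides o x cp.toSigPoly)) with
  | some x => x ≠ cp.fst
  | none => False

open scoped Classical in
/-- Insert `x` directly after the last element of the list that satisfies `P`, if there is one. -/
def insertAfterLast {α : Type*} (P : α → Prop) (x : α) : List α → Option (List α)
  | [] => none
  | a :: l =>
    match insertAfterLast P x l with
    | some l' => some (a :: l')
    | none => if P a then some (a :: x :: l) else none

open scoped Classical in
/-- Insert `x` directly before the first element of the list that satisfies `P`. -/
def insertBeforeFirst {α : Type*} (P : α → Prop) (x : α) : List α → List α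
  | [] => [x]
  | a :: l => if P a then x :: a :: l else a :: insertBeforeFirst P x l

/-- `insert_by_decreasing_l`: insert `x` after the last element `y` with `LM(y) ⪰_l LM(x)`, and if
there is none, before the first element whose index is that of `x`. -/
def insertByDecreasingL (x : SigPoly K n d) (SG : List (SigPoly K n d)) : List (SigPoly K n d) :=
  (insertAfterLast (fun y => LeL m o x y) x SG).getD
    (insertBeforeFirst (fun y => SameIdx o y x) x SG)

open scoped Classical in
/-- For each signature keep only the J-pair whose first component has the last position in `SG`. -/
def storeOne (SG : List (SigPoly K n d)) (CPs : Finset (JPair K n d)) : Finset (JPair K n d) :=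
  CPs.filter fun cp => ∀ cp' ∈ CPs, sig o cp'.toSigPoly = sig o cp.toSigPoly →
    SG.idxOf cp'.fst ≤ SG.idxOf cp.fst

open scoped Classical in
/-- The set `G_1` of elements of `SG` that are not syzygies. -/
def nonSyz (SG : List (SigPoly K n d)) : Finset (SigPoly K n d) :=
  SG.toFinset.filter fun x => x.poly ≠ 0

open scoped Classical in
/-- All J-pairs of `x` with the other non-syzygy elements of `SG`. -/
def newJPairs (x : SigPoly K n d) (SG : List (SigPoly K n d)) : Finset (JPair K n d) :=
  ((nonSyz SG).erase x).biUnion fun y => jPair m o x y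

/-- The principal syzygy `(p_x · u_y - p_y · u_x, 0)`. -/
def principalSyz (x y : SigPoly K n d) : SigPoly K n d :=
  ⟨fun i => x.poly * y.vec i - y.poly * x.vec i, 0⟩

open scoped Classical in
/-- The nonzero principal syzygies of `x` with the non-syzygy elements of `SG`. -/
def newPSyz (x : SigPoly K n d) (SG : List (SigPoly K n d)) : Finset (SigPoly K n d) :=
  ((nonSyz SG).image fun y => principalSyz x y).filter fun z => z.vec ≠ 0

/-- `B` is a result of discarding from the set `A` of syzygies those that are super top-reducible
by a remaining one: every discarded syzygy has a signature divisible by that of an element kept, and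
no element kept has a signature divisible by that of another one. -/
def DiscardSuper (A B : Finset (SigPoly K n d)) : Prop :=
  B ⊆ A ∧ (∀ z ∈ A, z ∉ B → ∃ y ∈ B, SigDivides o y z) ∧
    ∀ y ∈ B, ∀ z ∈ B, y ≠ z → ¬ SigDivides o y z

/-- `cp` is a J-pair of minimal signature in `CPs`. -/
def IsMinPair (CPs : Finset (JPair K n d)) (cp : JPair K n d) : Prop :=
  cp ∈ CPs ∧ ∀ cp' ∈ CPs, ∀ s t : ModMon n d,
    sig o cp.toSigPoly = s → sig o cp'.toSigPoly = t → o.le s t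

/-- The criteria of the algorithm: `cp` is neither ts-rewritable by `PSyz` nor F5-rewritable by
`SG`. -/
def PassesCriteria (PSyz : Finset (SigPoly K n d)) (SG : List (SigPoly K n d))
    (cp : JPair K n d) : Prop :=
  ¬ TsRewritable m o (PSyz : Set (SigPoly K n d)) cp.toSigPoly ∧ ¬ F5Rewritable o SG cp

/-! ### Interreduction and initialization -/

/-- One step of interreduction: delete a zero polynomial, or cancel a term of some `f` with a
multiple of another nonzero polynomial `g` of the list whose leading monomial divides that term. -/
inductive InterreduceStep :
    List (MvPolynomial (Fin n) K) → List (MvPolynomial (Fin n) K) → Prop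
  | drop (l₁ l₂ : List (MvPolynomial (Fin n) K)) :
      InterreduceStep (l₁ ++ 0 :: l₂) (l₁ ++ l₂)
  | cancel (l₁ l₂ : List (MvPolynomial (Fin n) K)) (f g : MvPolynomial (Fin n) K)
      (a : Fin n →₀ ℕ) (hg : g ∈ l₁ ++ l₂) (hg0 : g ≠ 0) (ha : a ∈ f.support)
      (hdvd : m.degree g ≤ a) :
      InterreduceStep (l₁ ++ f :: l₂)
        (l₁ ++ (f - monomial (a - m.degree g) (f.coeff a / m.leadingCoeff g) * g) :: l₂)

/-- No interreduction step applies: all polynomials are nonzero, and no term of one of them is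
divisible by the leading monomial of another one. -/
def Interreduced (P : List (MvPolynomial (Fin n) K)) : Prop :=
  ∀ P' : List (MvPolynomial (Fin n) K), ¬ InterreduceStep m P P'

/-- `Q` lists the elements of `P`, each up to a nonzero constant factor (so that an implementation
may, but need not, make them monic), by ascending leading monomials. -/
def SortedListing (P Q : List (MvPolynomial (Fin n) K)) : Prop :=
  (∃ P' : List (MvPolynomial (Fin n) K), P'.Perm P ∧
    List.Forall₂ (fun p q => ∃ c : K, c ≠ 0 ∧ q = C c * p) P' Q) ∧
  Q.Pairwise fun f g => m.toSyn (m.degree f) ≤ m.toSyn (m.degree g)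

/-- The initial sig-polynomials `F_i = (e_i, f_i)`. The interreduced list may be shorter than the
input; its free module is spanned by the first unit vectors of `R^d`. -/
def initPair (Q : List (MvPolynomial (Fin n) K)) (h : Q.length ≤ d) (i : Fin Q.length) :
    SigPoly K n d :=
  ⟨Pi.single (Fin.castLE h i) 1, Q.get i⟩

def initSG (Q : List (MvPolynomial (Fin n) K)) (h : Q.length ≤ d) : List (SigPoly K n d) :=
  List.ofFn (initPair Q h)

open scoped Classical in
def initCPs (Q : List (MvPolynomial (Fin n) K)) (h : Q.length ≤ d) : Finset (JPair K n d) :=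
  (Finset.univ.filter fun ij : Fin Q.length × Fin Q.length => ij.1 < ij.2).biUnion
    fun ij => jPair m o (initPair Q h ij.1) (initPair Q h ij.2)

open scoped Classical in
def initPSyz (Q : List (MvPolynomial (Fin n) K)) (h : Q.length ≤ d) : Finset (SigPoly K n d) :=
  (Finset.univ.filter fun ij : Fin Q.length × Fin Q.length => ij.1 < ij.2).image
    fun ij => principalSyz (initPair Q h ij.1) (initPair Q h ij.2)

open scoped Classical in
/-- The returned set of polynomials `{g | (u, g) ∈ SG, g ≠ 0}`. -/
def output (SG : List (SigPoly K n d)) : Finset (MvPolynomial (Fin n) K) :=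
  (nonSyz SG).image SigPoly.poly

end

/-! ### The algorithm as a transition system -/

/-- The states of the algorithm: interreducing the input, at the head of the while-loop, in the
middle of the tm-reduction of the chosen J-pair (whose current value is `cur`), halted. -/
inductive State (K : Type*) [Field K] (n d : ℕ) where
  | interreduce (P : List (MvPolynomial (Fin n) K)) : State K n d
  | loop (CPs : Finset (JPair K n d)) (SG : List (SigPoly K n d))
      (PSyz : Finset (SigPoly K n d)) : State K n d
  | reduce (cur : SigPoly K n d) (CPs : Finset (JPair K n d)) (SG : List (SigPoly K n d))
      (PSyz : Finset (SigPoly K n d)) : State K n d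
  | halt (G : Finset (MvPolynomial (Fin n) K)) : State K n d

section

variable {K : Type*} [Field K] {n d : ℕ} (m : MonomialOrder (Fin n)) (o : ModuleOrder n d)

open scoped Classical in
/-- One elementary step of the F5G algorithm. All choices that the algorithm leaves open (which
reducer to take, which of several super top-reducible syzygies to keep, ...) are nondeterministic. -/
inductive Step : State K n d → State K n d → Prop
  | interreduce (P P' : List (MvPolynomial (Fin n) K)) (hP : InterreduceStep m P P') :
      Step (.interreduce P) (.interreduce P')
  | init (P Q : List (MvPolynomial (Fin n) K)) (hP : Interreduced m P)
      (hQ : SortedListing m P Q) (h : Q.length ≤ d) :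
      Step (.interreduce P) (.loop (initCPs m o Q h) (initSG Q h) (initPSyz Q h))
  | discard (CPs : Finset (JPair K n d)) (SG : List (SigPoly K n d))
      (PSyz : Finset (SigPoly K n d)) (cp : JPair K n d) (hmin : IsMinPair o CPs cp)
      (hcrit : ¬ PassesCriteria m o PSyz SG cp) :
      Step (.loop CPs SG PSyz) (.loop (CPs.erase cp) SG PSyz)
  | pass (CPs : Finset (JPair K n d)) (SG : List (SigPoly K n d))
      (PSyz : Finset (SigPoly K n d)) (cp : JPair K n d) (hmin : IsMinPair o CPs cp)
      (hcrit : PassesCriteria m o PSyz SG cp) :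
      Step (.loop CPs SG PSyz) (.reduce cp.toSigPoly (CPs.erase cp) SG PSyz)
  | tmReduce (cur cur' : SigPoly K n d) (CPs : Finset (JPair K n d)) (SG : List (SigPoly K n d))
      (PSyz : Finset (SigPoly K n d)) (hred : TmReduces m o SG cur cur') :
      Step (.reduce cur CPs SG PSyz) (.reduce cur' CPs SG PSyz)
  | storeSyzygy (sp : SigPoly K n d) (CPs : Finset (JPair K n d)) (SG : List (SigPoly K n d))
      (PSyz : Finset (SigPoly K n d)) (hirr : ∀ z, ¬ TmReduces m o SG sp z) (hsp : sp.poly = 0) :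
      Step (.reduce sp CPs SG PSyz) (.loop CPs (insertByDecreasingL m o sp SG) PSyz)
  | store (sp : SigPoly K n d) (CPs : Finset (JPair K n d)) (SG SG' : List (SigPoly K n d))
      (PSyz PSyz' : Finset (SigPoly K n d)) (hirr : ∀ z, ¬ TmReduces m o SG sp z)
      (hsp : sp.poly ≠ 0) (hSG' : SG' = insertByDecreasingL m o sp SG)
      (hPSyz' : DiscardSuper o (PSyz ∪ newPSyz sp SG') PSyz') :
      Step (.reduce sp CPs SG PSyz) (.loop (storeOne o SG' (CPs ∪ newJPairs m o sp SG')) SG' PSyz')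
  | halt (SG : List (SigPoly K n d)) (PSyz : Finset (SigPoly K n d)) :
      Step (.loop ∅ SG PSyz) (.halt (output SG))

/-- The state in which a run on the input `F` starts. -/
def start (F : Fin d → MvPolynomial (Fin n) K) : State K n d := .interreduce (List.ofFn F)

/-- `S` can be reached by a run on the input `F`. -/
def Reachable (F : Fin d → MvPolynomial (Fin n) K) (S : State K n d) : Prop :=
  Relation.ReflTransGen (Step m o) (start F) S

/-- `G` is a Gröbner basis of the ideal `I`: `G ⊆ I`, `G` generates `I`, and the leading terms of
`G` generate the ideal of leading terms of `I`. -/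
def IsGroebnerBasis (G : Set (MvPolynomial (Fin n) K)) (I : Ideal (MvPolynomial (Fin n) K)) :
    Prop :=
  G ⊆ I ∧ Ideal.span G = I ∧
    Ideal.span (m.leadingTerm '' G) =
      Ideal.span (m.leadingTerm '' (I : Set (MvPolynomial (Fin n) K)))

end

end F5G

end

namespace F5G

/-! ### Module orders -/

namespace ModMon

variable {n d : ℕ}

/-! Attach to (u, p) the formal ratio lm(p)/lm(u), lowest when p = 0. Monomial multiples keep the
ratio, `LeL` compares ratios within one index, and x ts-rewrites y exactly when sig(x) divides
sig(y) and x has the strictly smaller ratio. All such comparisons are made after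
cross-multiplication (`tsRewrites_iff`, `leL_iff`).

Insertion keeps `SG` decreasing in ratio within each index, so an element later than the first
component of a J-pair, with signature dividing that of the pair, has at most its ratio. The F5 test
and ts-rewriting by `SG` can therefore differ only for equal ratios. Then a multiple of the later
element z has the same leading pair as the J-pair and is reducible by the same second component, so
z has a J-pair of its own with a signature dividing the given one. The covering invariant
`Inv.cover`, minimality of the chosen signature and uniqueness of stored pairs show that the chosen
pair is ts-rewritable after all (`Inv.passesCriteria_iff`).

Covering survives each round: the reduced pair has the same signature and a strictly smaller leading
monomial, so it ts-rewrites the processed pair and every pair which that one covered (`Inv.insert`).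
With no pending pairs left, all J-pairs are ts-rewritable, and induction on signatures yields a
Gröbner basis (`exists_divides_of_jPairs_rewritable`).

For termination, the leading pair of each inserted element is not a multiple of an earlier one
(`ReduceInv.leadPairs_ssubset`), so Dickson's lemma bounds the insertions. Between insertions the
set of pending pairs shrinks and tm-reduction lowers leading monomials; interreduction decreases a
multiset order. -/

lemma shift_zero (s : ModMon n d) : s.shift 0 = s := by simp [shift]

lemma shift_shift (a b : Fin n →₀ ℕ) (s : ModMon n d) :
    (s.shift b).shift a = s.shift (a + b) := by simp [shift, add_assoc]

lemma shift_injective (a : Fin n →₀ ℕ) :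
    Function.Injective (shift a : ModMon n d → ModMon n d) := by
  rintro ⟨s, i⟩ ⟨t, j⟩ h
  simpa [shift] using h

lemma shift_right_injective (s : ModMon n d) {a b : Fin n →₀ ℕ} (h : s.shift a = s.shift b) :
    a = b := by simpa [shift] using h

end ModMon

namespace ModuleOrder

variable {n d : ℕ} (o : ModuleOrder n d) {s t r : ModMon n d}

lemma le_refl (s : ModMon n d) : o.le s s := o.toLinearOrder.le_refl s

lemma le_trans (h : o.le s t) (h' : o.le t r) : o.le s r := o.toLinearOrder.le_trans _ _ _ h h'

lemma le_antisymm (h : o.le s t) (h' : o.le t s) : s = t := o.toLinearOrder.le_antisymm _ _ h h'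

lemma le_of_lt (h : o.lt s t) : o.le s t := by
  let := o.toLinearOrder
  exact _root_.le_of_lt h

lemma lt_of_le_of_lt (h : o.le s t) (h' : o.lt t r) : o.lt s r := by
  let := o.toLinearOrder
  exact _root_.lt_of_le_of_lt h h'

lemma lt_of_lt_of_le (h : o.lt s t) (h' : o.le t r) : o.lt s r := by
  let := o.toLinearOrder
  exact _root_.lt_of_lt_of_le h h'

lemma lt_irrefl (s : ModMon n d) : ¬ o.lt s s := by
  let := o.toLinearOrder
  exact _root_.lt_irrefl s

lemma not_le_of_lt (h : o.lt s t) : ¬ o.le t s :=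
  fun h' => o.lt_irrefl _ (o.lt_of_lt_of_le h h')

lemma lt_iff_le_and_ne : o.lt s t ↔ o.le s t ∧ s ≠ t := by
  let := o.toLinearOrder
  exact _root_.lt_iff_le_and_ne

lemma not_lt : ¬ o.lt s t ↔ o.le t s := by
  let := o.toLinearOrder
  exact _root_.not_lt

lemma shift_lt (a : Fin n →₀ ℕ) (h : o.lt s t) : o.lt (s.shift a) (t.shift a) := by
  rw [lt_iff_le_and_ne] at h ⊢
  exact ⟨o.shift_le a _ _ h.1, fun e => h.2 (ModMon.shift_injective a e)⟩

lemma shift_lt_iff (a : Fin n →₀ ℕ) : o.lt (s.shift a) (t.shift a) ↔ o.lt s t := by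
  refine ⟨fun h => ?_, o.shift_lt a⟩
  by_contra h'
  exact o.not_le_of_lt h (o.shift_le a _ _ (o.not_lt.1 h'))

lemma le_shift (a : Fin n →₀ ℕ) (s : ModMon n d) : o.le s (s.shift a) := by
  have := o.shift_le s.mon _ _ (o.unit_le a s.idx)
  simpa [ModMon.shift, le, add_comm] using this

lemma le_of_divides (h : s.Divides t) : o.le s t := by
  obtain ⟨a, rfl⟩ := h
  exact o.le_shift a s

/-- By Dickson's lemma on exponents and finiteness of the indices, an infinite descending chain
would contain an earlier member dividing a later one, and divisors are not larger. -/
lemma wellFounded_lt : WellFounded o.lt := by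
  let := o.toLinearOrder
  change WellFounded ((· < ·) : ModMon n d → ModMon n d → Prop)
  rw [RelEmbedding.wellFounded_iff_isEmpty]
  refine ⟨fun f => ?_⟩
  have hf : ∀ i j, i < j → f j < f i := fun i j h => f.map_rel_iff.2 h
  have hw : WellQuasiOrdered fun x y : Fin d × (Fin n →₀ ℕ) => x.1 = y.1 ∧ x.2 ≤ y.2 :=
    (Finite.wellQuasiOrdered (α := Fin d) (· = ·)).prod wellQuasiOrdered_le
  obtain ⟨i, j, hij, h1, h2⟩ := hw fun k => ((f k).idx, (f k).mon)
  refine o.not_le_of_lt (hf i j hij) (o.le_of_divides ⟨(f j).mon - (f i).mon, ?_⟩)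
  ext1
  · exact tsub_add_cancel_of_le h2
  · exact h1

variable {o} in
lemma Compatible.shift_lt_shift {m : MonomialOrder (Fin n)} (h : o.Compatible m)
    {a b : Fin n →₀ ℕ} (s : ModMon n d) :
    o.lt (s.shift a) (s.shift b) ↔ m.toSyn a < m.toSyn b := by
  rw [← not_iff_not, o.not_lt, _root_.not_lt]
  simpa [ModMon.shift] using h (b + s.mon) (a + s.mon) s.idx

/-! ### Leading monomials of vectors of polynomials -/

variable {K : Type*} [Field K]

lemma leadMon_eq_bot_iff (u : Fin d → MvPolynomial (Fin n) K) : o.leadMon u = ⊥ ↔ u = 0 := by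
  let := o.toLinearOrder
  simp only [leadMon, Finset.max_eq_bot, Finset.eq_empty_iff_forall_notMem, Finset.mem_biUnion,
    Finset.mem_univ, true_and, Finset.mem_image, MvPolynomial.mem_support_iff]
  constructor
  · refine fun h => funext fun i => MvPolynomial.ext _ _ fun a => ?_
    by_contra h'
    exact h ⟨a, i⟩ ⟨i, a, by simpa using h', rfl⟩
  · rintro rfl _ ⟨i, a, h, -⟩
    simp at h

/-- Trades the finite maximum for coefficients; leading monomials of multiples and differences are
computed from this form. -/
lemma leadMon_eq_coe_iff (u : Fin d → MvPolynomial (Fin n) K) (s : ModMon n d) :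
    o.leadMon u = s ↔ (u s.idx).coeff s.mon ≠ 0 ∧
      ∀ t : ModMon n d, (u t.idx).coeff t.mon ≠ 0 → o.le t s := by
  classical
  let := o.toLinearOrder
  set S : Finset (ModMon n d) :=
    Finset.univ.biUnion fun i => (u i).support.image fun a => (⟨a, i⟩ : ModMon n d) with hS
  have hmem : ∀ t : ModMon n d, t ∈ S ↔ (u t.idx).coeff t.mon ≠ 0 := by
    rintro ⟨a, i⟩
    simp [hS]
  have hmax : o.leadMon u = S.max := by
    rw [leadMon, hS]
  rw [hmax]
  constructor
  · intro h
    exact ⟨(hmem s).1 (Finset.mem_of_max h),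
      fun t ht => Finset.le_max_of_eq ((hmem t).2 ht) h⟩
  · rintro ⟨h1, h2⟩
    refine _root_.le_antisymm ?_ (Finset.le_max ((hmem s).2 h1))
    exact Finset.sup_le fun t ht => WithBot.coe_le_coe.2 (h2 t ((hmem t).1 ht))

lemma exists_leadMon {u : Fin d → MvPolynomial (Fin n) K} (h : u ≠ 0) :
    ∃ s : ModMon n d, o.leadMon u = s := by
  obtain ⟨s, hs⟩ := WithBot.ne_bot_iff_exists.1 (mt (o.leadMon_eq_bot_iff u).1 h)
  exact ⟨s, hs.symm⟩

lemma leadMon_single (i : Fin d) :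
    o.leadMon (Pi.single i 1 : Fin d → MvPolynomial (Fin n) K) = (⟨0, i⟩ : ModMon n d) := by
  classical
  rw [leadMon_eq_coe_iff]
  refine ⟨by simp, ?_⟩
  rintro ⟨b, j⟩ h
  by_cases hj : j = i
  · subst hj
    by_cases hb : b = 0
    · subst hb; exact o.le_refl _
    · simp [MvPolynomial.coeff_one, Ne.symm hb] at h
  · simp [hj] at h

lemma leadMon_monomial_mul {u : Fin d → MvPolynomial (Fin n) K} {s : ModMon n d}
    (h : o.leadMon u = s) (a : Fin n →₀ ℕ) {c : K} (hc : c ≠ 0) :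
    o.leadMon (fun i => monomial a c * u i) = (s.shift a : ModMon n d) := by
  rw [leadMon_eq_coe_iff] at h ⊢
  refine ⟨?_, ?_⟩
  · simp only [ModMon.shift, MvPolynomial.coeff_monomial_mul]
    exact mul_ne_zero hc h.1
  · rintro ⟨b, j⟩ hb
    rw [MvPolynomial.coeff_monomial_mul'] at hb
    split_ifs at hb with hab
    · have : o.le _ _ := o.shift_le a _ _ (h.2 ⟨b - a, j⟩ (right_ne_zero_of_mul hb))
      simpa [ModMon.shift, add_tsub_cancel_of_le hab] using this
    · exact absurd rfl hb

lemma leadMon_sub_of_lt {u v : Fin d → MvPolynomial (Fin n) K} {s t : ModMon n d}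
    (hu : o.leadMon u = s) (hv : o.leadMon v = t) (h : o.lt t s) :
    o.leadMon (u - v) = s := by
  rw [leadMon_eq_coe_iff] at *
  have h0 : (v s.idx).coeff s.mon = 0 := by
    by_contra h'
    exact o.not_le_of_lt h (hv.2 s h')
  refine ⟨by simpa [h0] using hu.1, fun r hr => ?_⟩
  by_cases h1 : (u r.idx).coeff r.mon = 0
  · refine o.le_trans (hv.2 r fun h2 => hr ?_) (o.le_of_lt h)
    simp [h1, h2]
  · exact hu.2 r h1

lemma leadMon_sub_lt {u v : Fin d → MvPolynomial (Fin n) K} {s t : ModMon n d}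
    (hu : o.leadMon u = s) (hv : o.leadMon v = s)
    (hc : (u s.idx).coeff s.mon = (v s.idx).coeff s.mon) (ht : o.leadMon (u - v) = t) :
    o.lt t s := by
  rw [leadMon_eq_coe_iff] at *
  rw [lt_iff_le_and_ne]
  refine ⟨?_, ?_⟩
  · by_cases h1 : (u t.idx).coeff t.mon = 0
    · refine hv.2 t fun h2 => ht.1 ?_
      simp [h1, h2]
    · exact hu.2 t h1
  · rintro rfl
    exact ht.1 (by simp [hc])

end ModuleOrder

/-! ### Inequalities in a cancellative monoid with a bottom element adjoined -/

section WithBot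

variable {α : Type*} [AddCommMonoid α] [LinearOrder α] [IsOrderedCancelAddMonoid α]

/-- Transitivity of A/r ≤ B/s ≤ C/t in cross-multiplied form. The numerators may be bottom (zero
polynomials); the denominators are genuine monomials and hence cancel. -/
lemma withBot_add_le_add_trans {A B C : WithBot α} {r s t : α} (h : A + s ≤ B + r)
    (h' : B + t ≤ C + s) : A + t ≤ C + r := by
  have h1 : A + t + s ≤ C + r + s := by
    calc A + t + s = A + s + t := add_right_comm _ _ _
      _ ≤ B + r + t := by gcongr
      _ = B + t + r := add_right_comm _ _ _
      _ ≤ C + s + r := by gcongr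
      _ = C + r + s := add_right_comm _ _ _
  exact (WithBot.add_le_add_iff_right (WithBot.coe_ne_bot)).1 h1

lemma withBot_add_lt_add_of_lt_of_le {A B C : WithBot α} {r s t : α} (h : A + s < B + r)
    (h' : B + t ≤ C + s) : A + t < C + r := by
  have h1 : A + t + s < C + r + s := by
    calc A + t + s = A + s + t := add_right_comm _ _ _
      _ < B + r + t := (WithBot.add_lt_add_iff_right (WithBot.coe_ne_bot)).2 h
      _ = B + t + r := add_right_comm _ _ _
      _ ≤ C + s + r := by gcongr
      _ = C + r + s := add_right_comm _ _ _
  exact (WithBot.add_lt_add_iff_right (WithBot.coe_ne_bot)).1 h1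

end WithBot

/-! ### Leading monomials, with `⊥` for the zero polynomial -/

section

variable {K : Type*} [Field K] {n d : ℕ} (m : MonomialOrder (Fin n)) (o : ModuleOrder n d)

/-- The leading monomial of a polynomial in the ordered monoid of `m`, `⊥` if it is zero. -/
noncomputable def deg (p : MvPolynomial (Fin n) K) : WithBot m.syn :=
  m.toWithBotSyn (m.withBotDegree p)

lemma deg_eq_bot_iff {p : MvPolynomial (Fin n) K} : deg m p = ⊥ ↔ p = 0 := by simp [deg]

lemma deg_zero : deg m (0 : MvPolynomial (Fin n) K) = ⊥ := (deg_eq_bot_iff m).2 rfl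

lemma deg_eq_coe {p : MvPolynomial (Fin n) K} (h : p ≠ 0) :
    deg m p = (m.toSyn (m.degree p) : m.syn) := by
  rw [deg, (m.withBotDegree_eq_coe_degree_iff p).2 h, m.toWithBotSyn_apply_coe]

lemma deg_monomial_mul (a : Fin n →₀ ℕ) {c : K} (hc : c ≠ 0) (p : MvPolynomial (Fin n) K) :
    deg m (monomial a c * p) = (m.toSyn a : m.syn) + deg m p := by
  classical
  rw [deg, m.withBotDegree_mul, map_add, m.withBotDegree_monomial, if_neg hc,
    m.toWithBotSyn_apply_coe, deg]

lemma le_deg {p : MvPolynomial (Fin n) K} {a : Fin n →₀ ℕ} (h : p.coeff a ≠ 0) :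
    (m.toSyn a : m.syn) ≤ deg m p := by
  have hp : p ≠ 0 := by rintro rfl; simp at h
  rw [deg_eq_coe m hp, WithBot.coe_le_coe]
  exact m.le_degree (by simpa using h)

lemma deg_lt_of_forall {p : MvPolynomial (Fin n) K} {A : WithBot m.syn} (hA : A ≠ ⊥)
    (h : ∀ a, p.coeff a ≠ 0 → (m.toSyn a : m.syn) < A) : deg m p < A := by
  by_cases hp : p = 0
  · rw [hp, deg_zero]
    exact bot_lt_iff_ne_bot.2 hA
  · rw [deg_eq_coe m hp]
    exact h _ (m.coeff_degree_ne_zero_iff.2 hp)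

lemma deg_sub_lt {p q : MvPolynomial (Fin n) K} (hp : p ≠ 0) (h : deg m p = deg m q)
    (hc : p.coeff (m.degree p) = q.coeff (m.degree p)) : deg m (p - q) < deg m p := by
  refine deg_lt_of_forall m (mt (deg_eq_bot_iff m).1 hp) fun a ha => lt_of_le_of_ne ?_ ?_
  · by_cases h1 : p.coeff a = 0
    · rw [h]
      refine le_deg m fun h2 => ha ?_
      simp [h1, h2]
    · exact le_deg m h1
  · rw [deg_eq_coe m hp]
    intro e
    obtain rfl : a = m.degree p := m.toSyn.injective (WithBot.coe_injective e)
    exact ha (by simp [hc])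

lemma deg_sub_of_lt {p q : MvPolynomial (Fin n) K} (h : deg m q < deg m p) :
    deg m (p - q) = deg m p := by
  rw [sub_eq_add_neg, deg, m.withBotDegree_add_of_lt, deg]
  rwa [m.withBotDegree_neg]

lemma deg_sub_of_lt' {p q : MvPolynomial (Fin n) K} (h : deg m p < deg m q) :
    deg m (p - q) = deg m q := by
  rw [← deg_sub_of_lt m h, ← neg_sub, deg, m.withBotDegree_neg, deg]

/-! ### Signatures and top-rewriting -/

variable {m o} {x y z : SigPoly K n d} {s t r : ModMon n d}

lemma sig_termMul (h : sig o x = s) (a : Fin n →₀ ℕ) {c : K} (hc : c ≠ 0) :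
    sig o (x.termMul a c) = (s.shift a : ModMon n d) :=
  o.leadMon_monomial_mul h a hc

lemma sig_toSigPoly (cp : JPair K n d) (h : sig o cp.fst = s) :
    sig o cp.toSigPoly = (s.shift cp.mult : ModMon n d) :=
  sig_termMul h _ one_ne_zero

lemma deg_toSigPoly (cp : JPair K n d) :
    deg m cp.toSigPoly.poly = (m.toSyn cp.mult : m.syn) + deg m cp.fst.poly :=
  deg_monomial_mul m _ one_ne_zero _

lemma sigDivides_iff (hx : sig o x = s) (hy : sig o y = t) : SigDivides o x y ↔ s.Divides t := by
  constructor
  · rintro ⟨s', t', hs, ht, h⟩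
    rw [hx, WithBot.coe_inj] at hs
    rw [hy, WithBot.coe_inj] at ht
    rwa [hs, ht]
  · exact fun h => ⟨s, t, hx, hy, h⟩

/-- The multiplier is t/s, so clearing it leaves a strict comparison of ratios. The strict
inequality already forces `y.poly ≠ 0`. -/
lemma tsRewrites_iff (hx : sig o x = s) (hy : sig o y = t) :
    TsRewrites m o x y ↔ s.Divides t ∧
      deg m x.poly + (m.toSyn t.mon : m.syn) < deg m y.poly + (m.toSyn s.mon : m.syn) := by
  have key : ∀ a : Fin n →₀ ℕ,
      (m.toWithBotSyn (a + m.withBotDegree x.poly) < m.toWithBotSyn (m.withBotDegree y.poly) ↔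
      deg m x.poly + (m.toSyn (s.shift a).mon : m.syn) <
        deg m y.poly + (m.toSyn s.mon : m.syn)) := by
    intro a
    rw [map_add, m.toWithBotSyn_apply_coe]
    simp only [ModMon.shift, map_add, WithBot.coe_add]
    rw [← add_assoc, WithBot.add_lt_add_iff_right WithBot.coe_ne_bot, deg, deg, add_comm]
  constructor
  · rintro ⟨-, s', t', a, hs, ht, h, hlt⟩
    rw [hx, WithBot.coe_inj] at hs
    rw [hy, WithBot.coe_inj] at ht
    subst hs ht h
    exact ⟨⟨a, rfl⟩, (key a).1 hlt⟩
  · rintro ⟨⟨a, rfl⟩, hlt⟩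
    refine ⟨fun h => ?_, s, _, a, hx, hy, rfl, (key a).2 hlt⟩
    rw [h, deg_zero, WithBot.bot_add] at hlt
    exact not_lt_bot hlt

/-- Rewriters are inherited upwards: enlarging the signature to a multiple keeps divisibility, and
raising the ratio keeps the strict inequality. -/
lemma TsRewrites.of_le (h : TsRewrites m o z x) (hx : sig o x = s) (hy : sig o y = t)
    (hst : s.Divides t)
    (hle : deg m x.poly + (m.toSyn t.mon : m.syn) ≤ deg m y.poly + (m.toSyn s.mon : m.syn)) :
    TsRewrites m o z y := by
  obtain ⟨-, r, s', -, hr, hs', -⟩ := id h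
  obtain rfl : s = s' := by rwa [hx, WithBot.coe_inj] at hs'
  rw [tsRewrites_iff hr hx] at h
  rw [tsRewrites_iff hr hy]
  refine ⟨?_, withBot_add_lt_add_of_lt_of_le h.2 hle⟩
  obtain ⟨⟨a, rfl⟩, -⟩ := h
  obtain ⟨b, rfl⟩ := hst
  exact ⟨b + a, (ModMon.shift_shift _ _ _).symm⟩

lemma leL_iff (hx : sig o x = s) (hy : sig o y = t) :
    LeL m o x y ↔ s.idx = t.idx ∧
      deg m x.poly + (m.toSyn t.mon : m.syn) ≤ deg m y.poly + (m.toSyn s.mon : m.syn) := by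
  constructor
  · rintro ⟨s', t', hs, ht, h, hle⟩
    rw [hx, WithBot.coe_inj] at hs
    rw [hy, WithBot.coe_inj] at ht
    subst hs ht
    simpa [deg, map_add] using And.intro h hle
  · rintro ⟨h, hle⟩
    refine ⟨s, t, hx, hy, h, ?_⟩
    simpa [deg, map_add] using hle

lemma sameIdx_iff (hx : sig o x = s) (hy : sig o y = t) : SameIdx o x y ↔ s.idx = t.idx := by
  constructor
  · rintro ⟨s', t', hs, ht, h⟩
    rw [hx, WithBot.coe_inj] at hs
    rw [hy, WithBot.coe_inj] at ht
    rwa [hs, ht]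
  · exact fun h => ⟨s, t, hx, hy, h⟩

lemma LeL.sameIdx (h : LeL m o x y) : SameIdx o y x := by
  obtain ⟨s, t, hs, ht, h, -⟩ := h
  exact ⟨t, s, ht, hs, h.symm⟩

lemma SameIdx.symm (h : SameIdx o x y) : SameIdx o y x := by
  obtain ⟨s, t, hs, ht, h⟩ := h
  exact ⟨t, s, ht, hs, h.symm⟩

lemma LeL.trans (h : LeL m o x y) (h' : LeL m o y z) : LeL m o x z := by
  obtain ⟨s, t, hs, ht, -⟩ := id h
  obtain ⟨-, r, -, hr, -⟩ := id h'
  rw [leL_iff hs ht] at h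
  rw [leL_iff ht hr] at h'
  rw [leL_iff hs hr]
  exact ⟨h.1.trans h'.1, withBot_add_le_add_trans h.2 h'.2⟩

/-- Within one index `LeL` is total, because ratios are compared in a linear order. -/
lemma SameIdx.leL_of_not_leL (h : SameIdx o x y) (h' : ¬ LeL m o x y) : LeL m o y x := by
  obtain ⟨s, t, hs, ht, h⟩ := h
  rw [leL_iff hs ht] at h'
  rw [leL_iff ht hs]
  exact ⟨h.symm, le_of_not_ge fun hle => h' ⟨h, hle⟩⟩

/-! ### Top-reduction -/

lemma TmReducesBy.sig_eq (h : TmReducesBy m o x y z) : sig o z = sig o y := by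
  obtain ⟨hx, hy, s, t, a, hs, ht, ha, hlt, hv, hp⟩ := h
  have hc : m.leadingCoeff y.poly / m.leadingCoeff x.poly ≠ 0 :=
    div_ne_zero (m.leadingCoeff_ne_zero_iff.2 hy) (m.leadingCoeff_ne_zero_iff.2 hx)
  rw [ht, sig, hv]
  exact o.leadMon_sub_of_lt ht (sig_termMul hs a hc) hlt

lemma TmReducesBy.deg_lt (h : TmReducesBy m o x y z) : deg m z.poly < deg m y.poly := by
  obtain ⟨hx, hy, s, t, a, hs, ht, ha, hlt, hv, hp⟩ := h
  have hx' := m.leadingCoeff_ne_zero_iff.2 hx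
  have hc : m.leadingCoeff y.poly / m.leadingCoeff x.poly ≠ 0 :=
    div_ne_zero (m.leadingCoeff_ne_zero_iff.2 hy) hx'
  rw [hp]
  refine deg_sub_lt m hy ?_ ?_
  · rw [SigPoly.termMul, deg_monomial_mul m a hc, deg_eq_coe m hx, deg_eq_coe m hy, ← ha, map_add,
      WithBot.coe_add]
  · simp only [SigPoly.termMul]
    rw [← ha, coeff_monomial_mul, ha]
    exact (div_mul_cancel₀ _ hx').symm

lemma exists_tmReducesBy (hx : x.poly ≠ 0) (hy : y.poly ≠ 0) (hs : sig o x = s) (ht : sig o y = t)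
    {a : Fin n →₀ ℕ} (ha : a + m.degree x.poly = m.degree y.poly) (hlt : o.lt (s.shift a) t) :
    ∃ z, TmReducesBy m o x y z :=
  ⟨⟨_, _⟩, hx, hy, s, t, a, hs, ht, ha, hlt, rfl, rfl⟩

/-! ### J-pairs -/

lemma mem_jPairFst {cp : JPair K n d} (hx : sig o x = s) (hy : sig o y = t) :
    cp ∈ jPairFst m o x y ↔ x.poly ≠ 0 ∧ y.poly ≠ 0 ∧ cp.fst = x ∧
      cp.mult = (m.degree x.poly ⊔ m.degree y.poly) - m.degree x.poly ∧
      o.lt (t.shift ((m.degree x.poly ⊔ m.degree y.poly) - m.degree y.poly))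
        (s.shift cp.mult) := by
  obtain ⟨a, w⟩ := cp
  rw [jPairFst]
  split_ifs with h
  · obtain ⟨h1, h2, s', t', hs, ht, hlt⟩ := h
    rw [hx, WithBot.coe_inj] at hs
    rw [hy, WithBot.coe_inj] at ht
    subst hs ht
    simp only [Finset.mem_singleton, JPair.mk.injEq]
    constructor
    · rintro ⟨rfl, rfl⟩
      exact ⟨h1, h2, rfl, rfl, hlt⟩
    · rintro ⟨-, -, rfl, rfl, -⟩
      exact ⟨rfl, rfl⟩
  · simp only [Finset.notMem_empty, false_iff]
    rintro ⟨h1, h2, rfl, rfl, hlt⟩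
    exact h ⟨h1, h2, s, t, hx, hy, hlt⟩

lemma exists_sig_of_mem_jPairFst {cp : JPair K n d} (h : cp ∈ jPairFst m o x y) :
    ∃ s t : ModMon n d, sig o x = s ∧ sig o y = t := by
  rw [jPairFst] at h
  split_ifs at h with h'
  · obtain ⟨-, -, s, t, hs, ht, -⟩ := h'
    exact ⟨s, t, hs, ht⟩
  · exact absurd h (Finset.notMem_empty _)

lemma mem_jPairFst_sup {cp : JPair K n d} (h : cp ∈ jPairFst m o x y) :
    ∃ (s t : ModMon n d) (b : Fin n →₀ ℕ), sig o x = s ∧ sig o y = t ∧ x.poly ≠ 0 ∧ y.poly ≠ 0 ∧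
      cp.fst = x ∧ b + m.degree y.poly = cp.mult + m.degree x.poly ∧
      o.lt (t.shift b) (s.shift cp.mult) := by
  obtain ⟨s, t, hs, ht⟩ := exists_sig_of_mem_jPairFst h
  obtain ⟨h1, h2, h3, h4, h5⟩ := (mem_jPairFst hs ht).1 h
  refine ⟨s, t, _, hs, ht, h1, h2, h3, ?_, h5⟩
  rw [h4, tsub_add_cancel_of_le le_sup_left, tsub_add_cancel_of_le le_sup_right]

lemma ne_of_mem_jPairFst {cp : JPair K n d} (h : cp ∈ jPairFst m o x y) : x ≠ y := by
  rintro rfl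
  obtain ⟨s, t, b, hs, ht, -, -, -, hb, hlt⟩ := mem_jPairFst_sup h
  rw [hs, WithBot.coe_inj] at ht
  subst ht
  rw [add_right_cancel hb] at hlt
  exact o.lt_irrefl _ hlt

/-- A multiple of `x` that is top-reducible by `y` is a multiple of the J-pair of `x` and `y`. -/
lemma exists_mem_jPairFst (hx : x.poly ≠ 0) (hy : y.poly ≠ 0) (hs : sig o x = s)
    (ht : sig o y = t) {a b : Fin n →₀ ℕ} (hab : a + m.degree x.poly = b + m.degree y.poly)
    (hlt : o.lt (t.shift b) (s.shift a)) :
    ∃ cp ∈ jPairFst m o x y, ∃ e, a = e + cp.mult := by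
  set l := m.degree x.poly ⊔ m.degree y.poly
  have hl : l ≤ a + m.degree x.poly := sup_le le_add_self (hab ▸ le_add_self)
  obtain ⟨e, he⟩ := exists_add_of_le hl
  have ha : a = e + (l - m.degree x.poly) := by
    apply add_right_cancel (b := m.degree x.poly)
    rw [add_assoc, tsub_add_cancel_of_le le_sup_left, he, add_comm]
  have hb : b = e + (l - m.degree y.poly) := by
    apply add_right_cancel (b := m.degree y.poly)
    rw [add_assoc, tsub_add_cancel_of_le le_sup_right, ← hab, he, add_comm]
  refine ⟨⟨l - m.degree x.poly, x⟩, (mem_jPairFst hs ht).2 ⟨hx, hy, rfl, rfl, ?_⟩, e, ha⟩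
  rw [ha, hb, ← ModMon.shift_shift, ← ModMon.shift_shift, o.shift_lt_iff] at hlt
  exact hlt

lemma mem_jPair {cp : JPair K n d} :
    cp ∈ jPair m o x y ↔ cp ∈ jPairFst m o x y ∨ cp ∈ jPairFst m o y x := by
  simp [jPair]

/-! ### Sig-polynomials of a family -/

/-- `x = (u, p)` satisfies `∑ u_i f_i = p`, and `u` is supported on `A`. -/
def Represents (f : Fin d → MvPolynomial (Fin n) K) (A : Set (Fin d)) (x : SigPoly K n d) : Prop :=
  ∑ i, x.vec i * f i = x.poly ∧ ∀ i ∉ A, x.vec i = 0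

variable {f : Fin d → MvPolynomial (Fin n) K} {A : Set (Fin d)}

lemma Represents.termMul (h : Represents f A x) (a : Fin n →₀ ℕ) (c : K) :
    Represents f A (x.termMul a c) := by
  refine ⟨?_, fun i hi => ?_⟩
  · simp only [SigPoly.termMul, ← h.1, Finset.mul_sum, mul_assoc]
  · simp only [SigPoly.termMul, h.2 i hi, mul_zero]

lemma Represents.sub (hx : Represents f A x) (hy : Represents f A y) :
    Represents f A ⟨x.vec - y.vec, x.poly - y.poly⟩ := by
  refine ⟨?_, fun i hi => ?_⟩
  · simp only [Pi.sub_apply, sub_mul, Finset.sum_sub_distrib, hx.1, hy.1]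
  · simp only [Pi.sub_apply, hx.2 i hi, hy.2 i hi, sub_zero]

lemma Represents.principalSyz (hx : Represents f A x) (hy : Represents f A y) :
    Represents f A (principalSyz x y) := by
  refine ⟨?_, fun i hi => ?_⟩
  · simp only [F5G.principalSyz, sub_mul, mul_assoc, Finset.sum_sub_distrib, ← Finset.mul_sum,
      hx.1, hy.1]
    ring
  · simp only [F5G.principalSyz, hx.2 i hi, hy.2 i hi, mul_zero, sub_zero]

lemma TmReducesBy.represents (h : TmReducesBy m o x y z) (hx : Represents f A x)
    (hy : Represents f A y) : Represents f A z := by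
  obtain ⟨-, -, s, t, a, -, -, -, -, hv, hp⟩ := h
  have := hy.sub (hx.termMul a (m.leadingCoeff y.poly / m.leadingCoeff x.poly))
  rwa [← hv, ← hp] at this

lemma Represents.idx_mem (h : Represents f A x) (hs : sig o x = s) : s.idx ∈ A := by
  by_contra hA
  have := ((o.leadMon_eq_coe_iff _ _).1 hs).1
  rw [h.2 _ hA] at this
  simp at this

lemma Represents.poly_mem_span (h : Represents f A x) : x.poly ∈ Ideal.span (f '' A) := by
  rw [← h.1]
  refine Ideal.sum_mem _ fun i _ => ?_
  by_cases hi : i ∈ A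
  · exact Ideal.mul_mem_left _ _ (Ideal.subset_span ⟨i, hi, rfl⟩)
  · rw [h.2 i hi, zero_mul]
    exact Ideal.zero_mem _

lemma exists_represents_of_mem_span {g : MvPolynomial (Fin n) K}
    (h : g ∈ Ideal.span (f '' A)) : ∃ x : SigPoly K n d, Represents f A x ∧ x.poly = g := by
  classical
  induction h using Submodule.span_induction with
  | mem g h =>
    obtain ⟨i, hi, rfl⟩ := h
    refine ⟨⟨Pi.single i 1, f i⟩, ⟨?_, fun j hj => ?_⟩, rfl⟩
    · rw [Finset.sum_eq_single i] <;> simp +contextual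
    · have : j ≠ i := by rintro rfl; exact hj hi
      simp [this]
  | zero => exact ⟨⟨0, 0⟩, ⟨by simp, by simp⟩, rfl⟩
  | add g g' _ _ h h' =>
    obtain ⟨x, hx, rfl⟩ := h
    obtain ⟨y, hy, rfl⟩ := h'
    refine ⟨⟨x.vec + y.vec, x.poly + y.poly⟩, ⟨?_, fun i hi => ?_⟩, rfl⟩
    · simp only [Pi.add_apply, add_mul, Finset.sum_add_distrib, hx.1, hy.1]
    · simp only [Pi.add_apply, hx.2 i hi, hy.2 i hi, add_zero]
  | smul a g _ h =>
    obtain ⟨x, hx, rfl⟩ := h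
    refine ⟨⟨fun i => a * x.vec i, a * x.poly⟩, ⟨?_, fun i hi => ?_⟩, rfl⟩
    · simp only [← hx.1, Finset.mul_sum, mul_assoc]
    · simp only [hx.2 i hi, mul_zero]

end

/-! ### Insertion into lists and positions in lists -/

section Lists

variable {α : Type*}

lemma insertAfterLast_spec (P : α → Prop) (x : α) (l : List α) :
    (insertAfterLast P x l = none ∧ ∀ y ∈ l, ¬ P y) ∨
    ∃ l₁ y l₂, l = l₁ ++ y :: l₂ ∧ P y ∧ (∀ z ∈ l₂, ¬ P z) ∧
      insertAfterLast P x l = some (l₁ ++ y :: x :: l₂) := by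
  induction l with
  | nil => exact Or.inl ⟨rfl, by simp⟩
  | cons a l ih =>
    rcases ih with ⟨h, hP⟩ | ⟨l₁, y, l₂, rfl, hy, hl₂, h⟩
    · by_cases ha : P a
      · exact Or.inr ⟨[], a, l, rfl, ha, hP, by simp [insertAfterLast, h, ha]⟩
      · exact Or.inl ⟨by simp [insertAfterLast, h, ha], by simpa [ha] using hP⟩
    · exact Or.inr ⟨a :: l₁, y, l₂, rfl, hy, hl₂, by simp [insertAfterLast, h]⟩

lemma insertBeforeFirst_spec (P : α → Prop) (x : α) (l : List α) :
    ∃ l₁ l₂, l = l₁ ++ l₂ ∧ (∀ y ∈ l₁, ¬ P y) ∧ insertBeforeFirst P x l = l₁ ++ x :: l₂ := by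
  induction l with
  | nil => exact ⟨[], [], rfl, by simp, rfl⟩
  | cons a l ih =>
    obtain ⟨l₁, l₂, rfl, hl₁, h⟩ := ih
    by_cases ha : P a
    · exact ⟨[], a :: (l₁ ++ l₂), rfl, by simp, by simp [insertBeforeFirst, ha]⟩
    · exact ⟨a :: l₁, l₂, rfl, by simpa [ha] using hl₁, by simp [insertBeforeFirst, ha, h]⟩

variable [DecidableEq α]

/-- Covering is phrased through positions, so it must survive insertion: a new entry shifts
positions but keeps the relative order of the old ones. -/
lemma idxOf_le_idxOf_insert {x a b : α} {l₁ l₂ : List α} (hx : x ∉ l₁ ++ l₂)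
    (ha : a ∈ l₁ ++ l₂) (hb : b ∈ l₁ ++ l₂) (h : (l₁ ++ l₂).idxOf a ≤ (l₁ ++ l₂).idxOf b) :
    (l₁ ++ x :: l₂).idxOf a ≤ (l₁ ++ x :: l₂).idxOf b := by
  have hxa : x ≠ a := by rintro rfl; exact hx ha
  have hxb : x ≠ b := by rintro rfl; exact hx hb
  simp only [List.idxOf_append, List.idxOf_cons_ne _ hxa, List.idxOf_cons_ne _ hxb] at h ⊢
  have h1 : ∀ c ∈ l₁, l₁.idxOf c < l₁.length := fun c hc => List.idxOf_lt_length_iff.2 hc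
  split_ifs at h ⊢ with h2 h3
  · exact h
  · have := h1 a h2; omega
  · have := h1 b (by assumption); omega
  · omega

lemma _root_.List.Pairwise.rel_of_idxOf_lt {R : α → α → Prop} {l : List α} (h : l.Pairwise R)
    {a b : α} (hb : b ∈ l) (hab : l.idxOf a < l.idxOf b) : R a b := by
  have hb' : l.idxOf b < l.length := List.idxOf_lt_length_iff.2 hb
  have := List.pairwise_iff_getElem.1 h _ _ (hab.trans hb') hb' hab
  simpa using this

lemma idxOf_lt_of_mem_left {x a : α} {l₁ l₂ : List α} (hl : (l₁ ++ x :: l₂).Nodup)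
    (ha : a ∈ l₁) : (l₁ ++ x :: l₂).idxOf a < (l₁ ++ x :: l₂).idxOf x := by
  have hx : x ∉ l₁ := fun hx => (List.nodup_append.1 hl).2.2 x hx x (by simp) rfl
  rw [List.idxOf_append_of_mem ha, List.idxOf_append_of_notMem hx]
  have := List.idxOf_lt_length_iff.2 ha
  omega

end Lists

/-! ### Lists of sig-polynomials in decreasing order -/

section

variable {K : Type*} [Field K] {n d : ℕ} {m : MonomialOrder (Fin n)} {o : ModuleOrder n d}
variable {x y z : SigPoly K n d} {s t r : ModMon n d}

/-- The elements of each index occur in descending order for `⪯_l`. -/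
def Descending (m : MonomialOrder (Fin n)) (o : ModuleOrder n d) (SG : List (SigPoly K n d)) :
    Prop :=
  SG.Pairwise fun x y => SameIdx o x y → LeL m o y x

lemma SameIdx.trans (h : SameIdx o x y) (h' : SameIdx o y z) : SameIdx o x z := by
  obtain ⟨s, t, hs, ht, h⟩ := h
  obtain ⟨t', r, ht', hr, h'⟩ := h'
  rw [ht, WithBot.coe_inj] at ht'
  subst ht'
  exact ⟨s, r, hs, hr, h.trans h'⟩

/-- Elements of the same index after the insertion point are not above `x`, hence below it by
totality; those before it are above the element after which `x` is placed, hence above `x`. If no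
element is above `x`, none of the same index precedes it. -/
lemma insertByDecreasingL_spec {SG : List (SigPoly K n d)} (h : Descending m o SG)
    (x : SigPoly K n d) :
    ∃ l₁ l₂, SG = l₁ ++ l₂ ∧ insertByDecreasingL m o x SG = l₁ ++ x :: l₂ ∧
      Descending m o (l₁ ++ x :: l₂) := by
  rw [insertByDecreasingL]
  rcases insertAfterLast_spec (fun y => LeL m o x y) x SG with
    ⟨hnone, hP⟩ | ⟨l₁, y, l₂, rfl, hy, hl₂, hsome⟩
  · obtain ⟨l₁, l₂, rfl, hl₁, heq⟩ := insertBeforeFirst_spec (fun y => SameIdx o y x) x SG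
    refine ⟨l₁, l₂, rfl, by rw [hnone, Option.getD_none, heq], ?_⟩
    rw [Descending, List.pairwise_append] at h
    rw [Descending, List.pairwise_append, List.pairwise_cons]
    refine ⟨h.1, ⟨fun z hz hxz => hxz.leL_of_not_leL (hP z (by simp [hz])), h.2.1⟩, ?_⟩
    intro z hz w hw
    rcases List.mem_cons.1 hw with rfl | hw
    · exact fun hzw => absurd hzw (hl₁ z hz)
    · exact h.2.2 z hz w hw
  · refine ⟨l₁ ++ [y], l₂, by simp, by simp [hsome], ?_⟩
    rw [Descending, List.pairwise_append, List.pairwise_cons] at h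
    have hx : ∀ z ∈ l₂, SameIdx o x z → LeL m o z x :=
      fun z hz hxz => hxz.leL_of_not_leL (hl₂ z hz)
    rw [Descending, List.append_assoc, List.singleton_append, List.pairwise_append,
      List.pairwise_cons, List.pairwise_cons]
    refine ⟨h.1, ⟨?_, hx, h.2.1.2⟩, ?_⟩
    · intro z hz
      rcases List.mem_cons.1 hz with rfl | hz
      · exact fun _ => hy
      · exact h.2.1.1 z hz
    · intro z hz w hw
      simp only [List.mem_cons] at hw
      rcases hw with rfl | rfl | hw
      · exact h.2.2 z hz w (by simp)
      · exact fun hzw => hy.trans (h.2.2 z hz y (by simp) (hzw.trans hy.sameIdx.symm))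
      · exact h.2.2 z hz w (by simp [hw])

open scoped Classical in
-- The first component itself passes the divisibility test, so the last element passing it differs
-- from the first component exactly when some such element comes later.
lemma f5Rewritable_iff {SG : List (SigPoly K n d)} (hnd : SG.Nodup) {cp : JPair K n d}
    (hmem : cp.fst ∈ SG) (hdvd : SigDivides o cp.fst cp.toSigPoly) :
    F5Rewritable o SG cp ↔
      ∃ x ∈ SG, SigDivides o x cp.toSigPoly ∧ SG.idxOf cp.fst < SG.idxOf x := by
  rw [F5Rewritable]
  split
  next x hx =>
    obtain ⟨hxd, as, bs, heq, has⟩ := List.find?_eq_some_iff_append.1 hx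
    simp only [decide_eq_true_eq, Bool.not_eq_true', decide_eq_false_iff_not] at hxd has
    have hSG : SG = bs.reverse ++ x :: as.reverse := by
      rw [← List.reverse_reverse SG, heq]
      simp
    rw [hSG] at hnd hmem ⊢
    constructor
    · intro hne
      refine ⟨x, by simp, hxd, ?_⟩
      simp only [List.mem_append, List.mem_cons, List.mem_reverse] at hmem
      rcases hmem with h | h | h
      · exact idxOf_lt_of_mem_left hnd (by simpa using h)
      · exact absurd h.symm hne
      · exact absurd hdvd (has _ h)
    · rintro ⟨y, hy, hyd, hlt⟩ rfl
      simp only [List.mem_append, List.mem_cons, List.mem_reverse] at hy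
      rcases hy with h | rfl | h
      · exact lt_asymm hlt (idxOf_lt_of_mem_left hnd (by simpa using h))
      · exact lt_irrefl _ hlt
      · exact has _ h hyd
  next hnone =>
    simp only [List.find?_eq_none, List.mem_reverse, decide_eq_true_eq] at hnone
    exact absurd hdvd (hnone _ hmem)

/-! ### The invariant of the main loop -/

open scoped Classical in
/-- The invariant of the main loop. The last field says that each J-pair of elements of `SG` is
ts-rewritable or preceded by a pending J-pair of the same signature whose first component comes
later in `SG`. -/
structure Inv (m : MonomialOrder (Fin n)) (o : ModuleOrder n d)
    (f : Fin d → MvPolynomial (Fin n) K) (A : Set (Fin d)) (CPs : Finset (JPair K n d))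
    (SG : List (SigPoly K n d)) (PSyz : Finset (SigPoly K n d)) : Prop where
  nodup : SG.Nodup
  descending : Descending m o SG
  represents : ∀ x ∈ SG, Represents f A x
  exists_sig : ∀ x ∈ SG, ∃ s : ModMon n d, sig o x = s
  generator : ∀ i ∈ A, ∃ x ∈ SG, sig o x = (⟨0, i⟩ : ModMon n d) ∧ x.poly = f i
  syzygy : ∀ z ∈ PSyz, Represents f A z ∧ z.poly = 0
  pair : ∀ cp ∈ CPs, ∃ x ∈ SG, ∃ y ∈ SG, cp ∈ jPairFst m o x y
  unique : ∀ cp ∈ CPs, ∀ cp' ∈ CPs, sig o cp.toSigPoly = sig o cp'.toSigPoly → cp = cp'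
  cover : ∀ x ∈ SG, ∀ y ∈ SG, ∀ cp ∈ jPairFst m o x y,
    TsRewritable m o ((PSyz : Set (SigPoly K n d)) ∪ {x : SigPoly K n d | x ∈ SG}) cp.toSigPoly ∨
      ∃ cp' ∈ CPs, sig o cp'.toSigPoly = sig o cp.toSigPoly ∧
        SG.idxOf cp.fst ≤ SG.idxOf cp'.fst

open scoped Classical in
lemma Descending.deg_le {SG : List (SigPoly K n d)} (h : Descending m o SG) (hx : x ∈ SG)
    (hy : y ∈ SG) (hs : sig o x = s) (ht : sig o y = t) (hidx : s.idx = t.idx)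
    (hle : SG.idxOf x ≤ SG.idxOf y) :
    deg m y.poly + (m.toSyn s.mon : m.syn) ≤ deg m x.poly + (m.toSyn t.mon : m.syn) := by
  rcases hle.lt_or_eq with hlt | heq
  · exact ((leL_iff ht hs).1 (List.Pairwise.rel_of_idxOf_lt h hy hlt
      ((sameIdx_iff hs ht).2 hidx))).2
  · obtain rfl := (List.idxOf_inj hx).1 heq
    rw [hs, WithBot.coe_inj] at ht
    rw [ht]

open scoped Classical in
-- For equal signatures, comparing ratios is comparing leading monomials; the later first component
-- has the smaller ratio.
lemma Descending.deg_toSigPoly_le {SG : List (SigPoly K n d)} (h : Descending m o SG)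
    {cp cp' : JPair K n d} (hx : cp.fst ∈ SG) (hy : cp'.fst ∈ SG) (hs : sig o cp.fst = s)
    (ht : sig o cp'.fst = t) (hsig : sig o cp.toSigPoly = sig o cp'.toSigPoly)
    (hle : SG.idxOf cp.fst ≤ SG.idxOf cp'.fst) :
    deg m cp'.toSigPoly.poly ≤ deg m cp.toSigPoly.poly := by
  rw [sig_toSigPoly cp hs, sig_toSigPoly cp' ht, WithBot.coe_inj] at hsig
  have h1 := h.deg_le hx hy hs ht (congrArg ModMon.idx hsig.symm).symm hle
  have h2 := congrArg (fun w => ((m.toSyn w.mon : m.syn) : WithBot m.syn)) hsig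
  simp only [ModMon.shift, map_add, WithBot.coe_add] at h2
  rw [deg_toSigPoly, deg_toSigPoly,
    ← WithBot.add_le_add_iff_right (WithBot.coe_ne_bot (a := m.toSyn s.mon))]
  calc (m.toSyn cp'.mult : m.syn) + deg m cp'.fst.poly + (m.toSyn s.mon : m.syn)
      ≤ (m.toSyn cp'.mult : m.syn) + (deg m cp.fst.poly + (m.toSyn t.mon : m.syn)) := by
        rw [add_assoc]; gcongr
    _ = ((m.toSyn cp'.mult : m.syn) + (m.toSyn t.mon : m.syn)) + deg m cp.fst.poly := by
        rw [add_comm (deg m cp.fst.poly), add_assoc]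
    _ = _ := by rw [← h2, add_right_comm]

/-! ### Agreement of the criteria with ts-rewritability -/

section Criteria

variable {f : Fin d → MvPolynomial (Fin n) K} {A : Set (Fin d)} {CPs : Finset (JPair K n d)}
  {SG : List (SigPoly K n d)} {PSyz : Finset (SigPoly K n d)}

/-- The criteria decide whether a J-pair of minimal signature is ts-rewritable. -/
theorem Inv.passesCriteria_iff (h : Inv m o f A CPs SG PSyz) {cp : JPair K n d}
    (hmin : IsMinPair o CPs cp) :
    PassesCriteria m o PSyz SG cp ↔
      ¬ TsRewritable m o ((PSyz : Set (SigPoly K n d)) ∪ {x : SigPoly K n d | x ∈ SG})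
        cp.toSigPoly := by
  classical
  obtain ⟨x, hx, y, hy, hcp⟩ := h.pair cp hmin.1
  obtain ⟨s, t, b, hs, ht, hx0, hy0, rfl, hb, hlt⟩ := mem_jPairFst_sup hcp
  set T := s.shift cp.mult with hT
  have hsT : sig o cp.toSigPoly = T := sig_toSigPoly cp hs
  rw [PassesCriteria, f5Rewritable_iff h.nodup hx ((sigDivides_iff hs hsT).2 ⟨_, rfl⟩)]
  have hTmon : ((m.toSyn T.mon : m.syn) : WithBot m.syn) =
      (m.toSyn cp.mult : m.syn) + (m.toSyn s.mon : m.syn) := by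
    rw [hT, ModMon.shift, map_add, WithBot.coe_add]
  -- A J-pair has the ratio of its first component, so the multiplier cancels.
  have key : ∀ (z : SigPoly K n d) (r : ModMon n d), sig o z = r → (TsRewrites m o z cp.toSigPoly ↔
      r.Divides T ∧ deg m z.poly + (m.toSyn s.mon : m.syn) <
        deg m cp.fst.poly + (m.toSyn r.mon : m.syn)) := by
    intro z r hr
    rw [tsRewrites_iff hr hsT, deg_toSigPoly, hTmon, add_left_comm, add_assoc,
      WithBot.add_lt_add_iff_left WithBot.coe_ne_bot]
  constructor
  · rintro ⟨h1, h2⟩ ⟨z, hz | hz, hzcp⟩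
    · exact h1 ⟨z, hz, hzcp⟩
    · obtain ⟨r, hr⟩ := h.exists_sig z hz
      rw [key z r hr] at hzcp
      refine h2 ⟨z, hz, (sigDivides_iff hr hsT).2 hzcp.1, ?_⟩
      -- A rewriter not later than the first component would have at least its ratio.
      by_contra hle
      obtain ⟨e, he⟩ := hzcp.1
      exact hzcp.2.not_ge (h.descending.deg_le hz hx hr hs (congrArg ModMon.idx he.symm).symm
        (not_lt.1 hle))
  · intro hts
    refine ⟨fun ⟨z, hz, hzcp⟩ => hts ⟨z, Or.inl hz, hzcp⟩, ?_⟩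
    rintro ⟨z, hz, hzd, hidx⟩
    obtain ⟨r, hr⟩ := h.exists_sig z hz
    rw [sigDivides_iff hr hsT] at hzd
    obtain ⟨e, he⟩ := hzd
    have hle := h.descending.deg_le hx hz hs hr (congrArg ModMon.idx he).symm hidx.le
    rcases hle.lt_or_eq with hlt' | heq
    · exact hts ⟨z, Or.inr hz, (key z r hr).2 ⟨⟨e, he⟩, hlt'⟩⟩
    -- From here on the ratios are equal. Then `e` times `z` has the leading pair of `cp`, and `y`
    -- reduces it with the same cofactor `b`, so `z` and `y` have a J-pair whose signature divides
    -- `T`.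
    have hz0 : z.poly ≠ 0 := by
      intro h0
      rw [h0, deg_zero, WithBot.bot_add, deg_eq_coe m hx0, ← WithBot.coe_add] at heq
      exact WithBot.bot_ne_coe heq
    have hmon : e + r.mon = cp.mult + s.mon := congrArg ModMon.mon he
    have hdeg : e + m.degree z.poly = cp.mult + m.degree cp.fst.poly := by
      rw [deg_eq_coe m hz0, deg_eq_coe m hx0, ← WithBot.coe_add, ← WithBot.coe_add,
        WithBot.coe_inj, ← map_add, ← map_add, m.toSyn.injective.eq_iff] at heq
      apply add_right_cancel (b := s.mon)
      rw [add_assoc, heq, add_left_comm, hmon, add_right_comm, add_comm, add_right_comm]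
    obtain ⟨cp₂, hcp₂, e', he'⟩ := exists_mem_jPairFst hz0 hy0 hr ht
      (hdeg.trans hb.symm) (by rw [he]; exact hlt)
    have hfst : cp₂.fst = z := ((mem_jPairFst hr ht).1 hcp₂).2.2.1
    have hs₂ : sig o cp₂.toSigPoly = (r.shift cp₂.mult : ModMon n d) :=
      sig_toSigPoly cp₂ (by rw [hfst, hr])
    have hdvd : (r.shift cp₂.mult).Divides T := ⟨e', by rw [ModMon.shift_shift, ← he', he]⟩
    rcases h.cover z hz y hy cp₂ hcp₂ with ⟨w, hw, hwcp⟩ | ⟨cp', hcp', hsig, hle'⟩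
    · refine hts ⟨w, hw, hwcp.of_le hs₂ hsT hdvd (le_of_eq ?_)⟩
      rw [deg_toSigPoly, deg_toSigPoly, hfst, deg_eq_coe m hz0, deg_eq_coe m hx0]
      simp only [← WithBot.coe_add, ← map_add, WithBot.coe_inj, m.toSyn.injective.eq_iff]
      rw [← hdeg, hT, ModMon.shift, ← hmon, ModMon.shift]
      simp only
      abel
    -- Minimality makes the covering pair have signature `T`, and uniqueness identifies it with
    -- `cp`. Its first component would then be no earlier than `z`, although `z` comes strictly
    -- later.
    · have hle₂ := hmin.2 cp' hcp' _ _ hsT (hsig.trans hs₂)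
      have heq₂ : T = r.shift cp₂.mult := o.le_antisymm hle₂ (o.le_of_divides hdvd)
      have : cp = cp' := h.unique _ hmin.1 _ hcp' (by rw [hsT, hsig, hs₂, heq₂])
      rw [hfst, ← this] at hle'
      exact hidx.not_ge hle'

end Criteria

/-! ### Correctness -/

/-- If `S` represents a module generated by unit vectors and rewrites all its J-pairs, then the
leading monomial of each represented polynomial is divisible by that of an element of `S`, and the
multiple has no larger signature. -/
theorem exists_divides_of_jPairs_rewritable {f : Fin d → MvPolynomial (Fin n) K} {A : Set (Fin d)}
    {S : Set (SigPoly K n d)} (hS : ∀ x ∈ S, Represents f A x)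
    (hgen : ∀ i ∈ A, ∃ x ∈ S, sig o x = (⟨0, i⟩ : ModMon n d))
    (hJ : ∀ x ∈ S, ∀ y ∈ S, ∀ cp ∈ jPairFst m o x y, TsRewritable m o S cp.toSigPoly)
    (T : ModMon n d) (u : SigPoly K n d) (hT : sig o u = T) (hu : Represents f A u)
    (hu0 : u.poly ≠ 0) :
    ∃ x ∈ S, ∃ (s : ModMon n d) (a : Fin n →₀ ℕ), sig o x = s ∧ x.poly ≠ 0 ∧
      a + m.degree x.poly = m.degree u.poly ∧ o.le (s.shift a) T := by
  induction T using o.wellFounded_lt.induction generalizing u with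
  | _ T ih =>
  -- Among the multiples of elements of `S` with signature `T`, take one with least leading
  -- monomial; multiples of a generator show that there are any.
  obtain ⟨v, ⟨x, hx, s, a, hs, rfl, rfl⟩, hmin⟩ := (wellFounded_lt (α := WithBot m.syn)).has_min
    {v | ∃ x ∈ S, ∃ (s : ModMon n d) (a : Fin n →₀ ℕ), sig o x = s ∧ s.shift a = T ∧
      v = (m.toSyn a : m.syn) + deg m x.poly} (by
    obtain ⟨x, hx, hs⟩ := hgen T.idx (hu.idx_mem hT)
    exact ⟨_, x, hx, _, T.mon, hs, by simp [ModMon.shift], rfl⟩)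
  -- The chosen multiple is not tm-reducible by `S`: otherwise it is a multiple of a J-pair, whose
  -- rewriter gives a multiple of signature `T` with smaller leading monomial.
  have hirr : x.poly ≠ 0 → ∀ w ∈ S, ∀ (r : ModMon n d) (b : Fin n →₀ ℕ), sig o w = r →
      w.poly ≠ 0 → b + m.degree w.poly = a + m.degree x.poly →
      ¬ o.lt (r.shift b) (s.shift a) := by
    intro hx0 w hw r b hr hw0 hb hlt
    obtain ⟨cp, hcp, e, rfl⟩ := exists_mem_jPairFst hx0 hw0 hs hr hb.symm hlt
    obtain ⟨z, hz, hzcp⟩ := hJ x hx w hw cp hcp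
    have hfst : cp.fst = x := ((mem_jPairFst hs hr).1 hcp).2.2.1
    have hscp : sig o cp.toSigPoly = (s.shift cp.mult : ModMon n d) :=
      sig_toSigPoly cp (by rw [hfst, hs])
    have := hzcp.of_le hscp (sig_termMul hs (e + cp.mult) (one_ne_zero (α := K)))
      ⟨e, ModMon.shift_shift _ _ _⟩ (le_of_eq (by
        rw [deg_toSigPoly, hfst, SigPoly.termMul, deg_monomial_mul m _ one_ne_zero]
        simp only [ModMon.shift, map_add, WithBot.coe_add]
        ac_rfl))
    obtain ⟨-, q, q', a₁, hq, hq', hqq', hlt'⟩ := this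
    rw [sig_termMul hs _ one_ne_zero, WithBot.coe_inj] at hq'
    refine hmin _ ⟨z, hz, q, a₁, hq, hqq'.trans hq'.symm, rfl⟩ ?_
    rw [map_add, m.toWithBotSyn_apply_coe] at hlt'
    rw [← deg_monomial_mul m (e + cp.mult) (one_ne_zero (α := K))]
    exact hlt'
  have hxs := ((o.leadMon_eq_coe_iff _ _).1 hs).1
  have huT := ((o.leadMon_eq_coe_iff _ _).1 hT).1
  -- This constant cancels the leading module terms, so that the difference has a smaller signature
  -- and falls under the induction hypothesis.
  set c := (u.vec s.idx).coeff (a + s.mon) / (x.vec s.idx).coeff s.mon with hc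
  have hc0 : c ≠ 0 := div_ne_zero huT hxs
  have hself : deg m u.poly = deg m (monomial a c * x.poly) →
      ∃ x ∈ S, ∃ (s' : ModMon n d) (a' : Fin n →₀ ℕ), sig o x = s' ∧ x.poly ≠ 0 ∧
        a' + m.degree x.poly = m.degree u.poly ∧ o.le (s'.shift a') (s.shift a) := by
    intro hdeg
    have hx0 : x.poly ≠ 0 := by
      intro h0
      rw [h0, mul_zero, deg_zero, deg_eq_bot_iff] at hdeg
      exact hu0 hdeg
    refine ⟨x, hx, s, a, hs, hx0, ?_, o.le_refl _⟩
    rw [deg_monomial_mul m a hc0, deg_eq_coe m hu0, deg_eq_coe m hx0, ← WithBot.coe_add,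
      ← map_add, WithBot.coe_inj, m.toSyn.injective.eq_iff] at hdeg
    exact hdeg.symm
  have hv := hu.sub ((hS x hx).termMul a c)
  set v : SigPoly K n d := ⟨u.vec - (x.termMul a c).vec, u.poly - (x.termMul a c).poly⟩ with hvdef
  by_cases hv0 : v.poly = 0
  · refine hself ?_
    have : u.poly = (x.termMul a c).poly := sub_eq_zero.1 hv0
    rw [this, SigPoly.termMul]
  have hvec : v.vec ≠ 0 := by
    intro h0
    rw [← hv.1, h0] at hv0
    simp at hv0
  obtain ⟨T', hT'⟩ := o.exists_leadMon hvec
  have hlt : o.lt T' (s.shift a) := by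
    refine o.leadMon_sub_lt hT (sig_termMul hs a hc0) ?_ hT'
    simp only [SigPoly.termMul, ModMon.shift, coeff_monomial_mul]
    exact (div_mul_cancel₀ _ hxs).symm
  obtain ⟨w, hw, r, b, hr, hw0, hb, hle⟩ := ih T' hlt v hT' hv hv0
  have hvd : deg m v.poly = deg m (u.poly - monomial a c * x.poly) := rfl
  rcases lt_trichotomy (deg m u.poly) (deg m (monomial a c * x.poly)) with h | h | h
  -- Here the difference inherits the leading monomial of the chosen multiple, which `w` would then
  -- reduce.
  · exfalso
    rw [deg_sub_of_lt' m h] at hvd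
    have hx0 : x.poly ≠ 0 := by
      intro h0
      rw [h0, mul_zero, deg_zero] at h
      exact not_lt_bot h
    rw [deg_monomial_mul m a hc0, deg_eq_coe m hv0, deg_eq_coe m hx0, ← WithBot.coe_add,
      ← map_add, WithBot.coe_inj, m.toSyn.injective.eq_iff] at hvd
    exact hirr hx0 w hw r b hr hw0 (hb.trans hvd) (o.lt_of_le_of_lt hle hlt)
  · exact hself h
  · rw [deg_sub_of_lt m h, deg_eq_coe m hv0, deg_eq_coe m hu0, WithBot.coe_inj,
      m.toSyn.injective.eq_iff] at hvd
    exact ⟨w, hw, r, b, hr, hw0, hb.trans hvd, o.le_trans hle (o.le_of_lt hlt)⟩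

/-- When no J-pairs are left, the polynomials found form a Gröbner basis. -/
theorem Inv.isGroebnerBasis_output {f : Fin d → MvPolynomial (Fin n) K} {A : Set (Fin d)}
    {SG : List (SigPoly K n d)} {PSyz : Finset (SigPoly K n d)} (h : Inv m o f A ∅ SG PSyz) :
    IsGroebnerBasis m (output SG : Set (MvPolynomial (Fin n) K)) (Ideal.span (f '' A)) := by
  classical
  have hout : ∀ x : SigPoly K n d, x ∈ SG → x.poly ≠ 0 → x.poly ∈ output SG := by
    intro x hx hx0
    simp only [output, nonSyz, Finset.mem_image, Finset.mem_filter, List.mem_toFinset]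
    exact ⟨x, ⟨hx, hx0⟩, rfl⟩
  have hsub : (output SG : Set (MvPolynomial (Fin n) K)) ⊆ Ideal.span (f '' A) := by
    intro p hp
    simp only [output, nonSyz, Finset.coe_image, Set.mem_image, Finset.mem_coe,
      Finset.mem_filter, List.mem_toFinset] at hp
    obtain ⟨x, ⟨hx, -⟩, rfl⟩ := hp
    exact (h.represents x hx).poly_mem_span
  refine ⟨hsub, le_antisymm (Ideal.span_le.2 hsub) (Ideal.span_le.2 ?_),
    le_antisymm (Ideal.span_mono (Set.image_mono hsub)) (Ideal.span_le.2 ?_)⟩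
  · rintro _ ⟨i, hi, rfl⟩
    obtain ⟨x, hx, -, hxi⟩ := h.generator i hi
    rw [← hxi]
    by_cases hx0 : x.poly = 0
    · rw [hx0]
      exact Ideal.zero_mem _
    · exact Ideal.subset_span (hout x hx hx0)
  · rintro _ ⟨g, hg, rfl⟩
    by_cases hg0 : g = 0
    · rw [hg0, m.leadingTerm_zero]
      exact Ideal.zero_mem _
    obtain ⟨u, hu, rfl⟩ := exists_represents_of_mem_span hg
    have hvec : u.vec ≠ 0 := by
      intro h0
      rw [← hu.1, h0] at hg0
      simp at hg0
    obtain ⟨T, hT⟩ := o.exists_leadMon hvec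
    -- Syzygies join `S` only as rewriters: J-pairs need nonzero polynomial parts, so they come from
    -- `SG`.
    set S := (PSyz : Set (SigPoly K n d)) ∪ {x : SigPoly K n d | x ∈ SG} with hS
    have hmem : ∀ x ∈ S, x.poly ≠ 0 → x ∈ SG := by
      rintro x (hx | hx) hx0
      · exact absurd (h.syzygy x hx).2 hx0
      · exact hx
    obtain ⟨x, hx, s, a, hs, hx0, ha, -⟩ := exists_divides_of_jPairs_rewritable (S := S) (m := m)
      (o := o) (f := f) (A := A) (by
        rintro x (hx | hx)
        · exact (h.syzygy x hx).1
        · exact h.represents x hx) (by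
        intro i hi
        obtain ⟨x, hx, hxi, -⟩ := h.generator i hi
        exact ⟨x, Or.inr hx, hxi⟩) (by
        intro x hx y hy cp hcp
        obtain ⟨-, -, -, -, -, hx0, hy0, -⟩ := mem_jPairFst_sup hcp
        rcases h.cover x (hmem x hx hx0) y (hmem y hy hy0) cp hcp with hts | ⟨cp', hcp', -⟩
        · exact hts
        · exact absurd hcp' (Finset.notMem_empty _)) T u hT hu hg0
    have hlt : m.leadingTerm u.poly =
        monomial a (m.leadingCoeff u.poly / m.leadingCoeff x.poly) * m.leadingTerm x.poly := by
      rw [MonomialOrder.leadingTerm, MonomialOrder.leadingTerm, monomial_mul, ha,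
        div_mul_cancel₀ _ (m.leadingCoeff_ne_zero_iff.2 hx0)]
    rw [hlt]
    exact Ideal.mul_mem_left _ _ (Ideal.subset_span ⟨_, hout x (hmem x hx hx0) hx0, rfl⟩)

end

/-! ### Preservation of the invariant -/

section

variable {K : Type*} [Field K] {n d : ℕ} {m : MonomialOrder (Fin n)} {o : ModuleOrder n d}
  {f : Fin d → MvPolynomial (Fin n) K} {A : Set (Fin d)} {CPs : Finset (JPair K n d)}
  {SG : List (SigPoly K n d)} {PSyz : Finset (SigPoly K n d)} {sp : SigPoly K n d}

lemma fst_eq_of_mem_jPairFst {x y : SigPoly K n d} {cp : JPair K n d}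
    (h : cp ∈ jPairFst m o x y) : cp.fst = x := by
  obtain ⟨_, _, _, _, _, _, _, h, _⟩ := mem_jPairFst_sup h
  exact h

lemma Inv.fst_mem (h : Inv m o f A CPs SG PSyz) {cp : JPair K n d} (hcp : cp ∈ CPs) :
    cp.fst ∈ SG := by
  obtain ⟨x, hx, y, -, hxy⟩ := h.pair cp hcp
  rwa [fst_eq_of_mem_jPairFst hxy]

open scoped Classical in
-- The reason for covering by later first components: at equal signature the covering pair has the
-- smaller leading monomial, so its rewriters also rewrite the covered pair.
lemma Inv.tsRewritable_of_idxOf_le (h : Inv m o f A CPs SG PSyz) {B : Set (SigPoly K n d)}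
    {cp cp' : JPair K n d} (hx : cp.fst ∈ SG) (hy : cp'.fst ∈ SG)
    (hsig : sig o cp'.toSigPoly = sig o cp.toSigPoly)
    (hle : SG.idxOf cp.fst ≤ SG.idxOf cp'.fst) (hts : TsRewritable m o B cp'.toSigPoly) :
    TsRewritable m o B cp.toSigPoly := by
  obtain ⟨z, hz, hzcp⟩ := hts
  obtain ⟨s, hs⟩ := h.exists_sig _ hx
  obtain ⟨t, ht⟩ := h.exists_sig _ hy
  have hT := sig_toSigPoly cp hs
  refine ⟨z, hz, hzcp.of_le (hsig.trans hT) hT ⟨0, ModMon.shift_zero _⟩ ?_⟩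
  gcongr
  exact h.descending.deg_toSigPoly_le hx hy hs ht hsig.symm hle

lemma tsRewrites_of_deg_lt {x y : SigPoly K n d} {s : ModMon n d} (hx : sig o x = sig o y)
    (hs : sig o y = s) (h : deg m x.poly < deg m y.poly) : TsRewrites m o x y := by
  rw [tsRewrites_iff (hx.trans hs) hs]
  exact ⟨⟨0, ModMon.shift_zero _⟩, (WithBot.add_lt_add_iff_right WithBot.coe_ne_bot).2 h⟩

lemma Inv.exists_sig_toSigPoly (h : Inv m o f A CPs SG PSyz) {cp : JPair K n d}
    (hcp : cp ∈ CPs) : ∃ s : ModMon n d, sig o cp.toSigPoly = s := by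
  obtain ⟨s, hs⟩ := h.exists_sig _ (h.fst_mem hcp)
  exact ⟨_, sig_toSigPoly cp hs⟩

open scoped Classical in
lemma Inv.discard (h : Inv m o f A CPs SG PSyz) {cp : JPair K n d} (hcp : cp ∈ CPs)
    (hts : TsRewritable m o ((PSyz : Set (SigPoly K n d)) ∪ {x : SigPoly K n d | x ∈ SG})
      cp.toSigPoly) : Inv m o f A (CPs.erase cp) SG PSyz where
  nodup := h.nodup
  descending := h.descending
  represents := h.represents
  exists_sig := h.exists_sig
  generator := h.generator
  syzygy := h.syzygy
  pair c hc := h.pair c (Finset.mem_of_mem_erase hc)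
  unique c hc c' hc' := h.unique c (Finset.mem_of_mem_erase hc) c' (Finset.mem_of_mem_erase hc')
  cover x hx y hy c hc := by
    rcases h.cover x hx y hy c hc with h1 | ⟨c', hc', hsig, hle⟩
    · exact Or.inl h1
    · by_cases he : c' = cp
      · subst he
        exact Or.inl (h.tsRewritable_of_idxOf_le (by rwa [fst_eq_of_mem_jPairFst hc])
          (h.fst_mem hc') hsig hle hts)
      · exact Or.inr ⟨c', Finset.mem_erase.2 ⟨he, hc'⟩, hsig, hle⟩

/-- An element already in `SG` with these data would ts-rewrite `cp`. This keeps `SG` free of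
duplicates. -/
lemma Inv.notMem_of_deg_lt (h : Inv m o f A CPs SG PSyz) {cp : JPair K n d} (hcp : cp ∈ CPs)
    (hts : ¬ TsRewritable m o ((PSyz : Set (SigPoly K n d)) ∪ {x : SigPoly K n d | x ∈ SG})
      cp.toSigPoly)
    (hsig : sig o sp = sig o cp.toSigPoly) (hdeg : deg m sp.poly < deg m cp.toSigPoly.poly) :
    sp ∉ SG := by
  intro hsp
  obtain ⟨s, hs⟩ := h.exists_sig_toSigPoly hcp
  exact hts ⟨sp, Or.inr hsp, tsRewrites_of_deg_lt hsig hs hdeg⟩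

open scoped Classical in
-- The common core of storing a syzygy and a non-syzygy. The hypotheses `hold` and `hnew` ask that
-- surviving and new J-pairs be covered; pairs covered by `cp` itself become ts-rewritable by `sp`.
lemma Inv.insert (h : Inv m o f A CPs SG PSyz) {cp : JPair K n d} (hcp : cp ∈ CPs)
    (hts : ¬ TsRewritable m o ((PSyz : Set (SigPoly K n d)) ∪ {x : SigPoly K n d | x ∈ SG})
      cp.toSigPoly)
    (hrep : Represents f A sp) (hsig : sig o sp = sig o cp.toSigPoly)
    (hdeg : deg m sp.poly < deg m cp.toSigPoly.poly)
    {SG' : List (SigPoly K n d)} (hSG' : SG' = insertByDecreasingL m o sp SG)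
    {CPs' : Finset (JPair K n d)} {PSyz' : Finset (SigPoly K n d)}
    (hsyz : ∀ z ∈ PSyz', Represents f A z ∧ z.poly = 0)
    (hdvd : ∀ z ∈ PSyz, z ∉ PSyz' → ∃ y ∈ PSyz', SigDivides o y z)
    (hpair : ∀ cp ∈ CPs', ∃ x ∈ SG', ∃ y ∈ SG', cp ∈ jPairFst m o x y)
    (huniq : ∀ c ∈ CPs', ∀ c' ∈ CPs', sig o c.toSigPoly = sig o c'.toSigPoly → c = c')
    (hold : ∀ c ∈ CPs.erase cp, ∃ c' ∈ CPs', sig o c'.toSigPoly = sig o c.toSigPoly ∧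
      SG'.idxOf c.fst ≤ SG'.idxOf c'.fst)
    (hnew : ∀ x ∈ SG', x ≠ sp → x.poly ≠ 0 → sp.poly ≠ 0 → ∀ c ∈ jPair m o sp x,
      ∃ c' ∈ CPs', sig o c'.toSigPoly = sig o c.toSigPoly ∧
        SG'.idxOf c.fst ≤ SG'.idxOf c'.fst) :
    Inv m o f A CPs' SG' PSyz' := by
  have hspSG := h.notMem_of_deg_lt hcp hts hsig hdeg
  obtain ⟨T, hT⟩ := h.exists_sig_toSigPoly hcp
  obtain ⟨l₁, l₂, hl, hl', hdesc⟩ := insertByDecreasingL_spec h.descending sp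
  rw [hl'] at hSG'
  have hmem : ∀ x, x ∈ SG' ↔ x = sp ∨ x ∈ SG := by
    intro x
    rw [hSG', hl]
    simp only [List.mem_append, List.mem_cons]
    tauto
  refine ⟨?_, hSG' ▸ hdesc, ?_, ?_, ?_, hsyz, hpair, huniq, ?_⟩
  · rw [hSG', List.nodup_middle, List.nodup_cons, ← hl]
    exact ⟨hspSG, h.nodup⟩
  · intro x hx
    rcases (hmem x).1 hx with rfl | hx
    · exact hrep
    · exact h.represents x hx
  · intro x hx
    rcases (hmem x).1 hx with rfl | hx
    · exact ⟨T, hsig.trans hT⟩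
    · exact h.exists_sig x hx
  · intro i hi
    obtain ⟨x, hx, hxi⟩ := h.generator i hi
    exact ⟨x, (hmem x).2 (Or.inr hx), hxi⟩
  · intro x hx y hy c hc
    obtain ⟨-, -, -, -, -, hx0, hy0, hfst, -⟩ := mem_jPairFst_sup hc
    have hxy := ne_of_mem_jPairFst hc
    rcases (hmem x).1 hx with rfl | hx'
    · exact Or.inr (hnew y hy hxy.symm hy0 hx0 c (mem_jPair.2 (Or.inl hc)))
    rcases (hmem y).1 hy with rfl | hy'
    · exact Or.inr (hnew x hx hxy hx0 hy0 c (mem_jPair.2 (Or.inr hc)))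
    rcases h.cover x hx' y hy' c hc with ⟨z, hz | hz, hzc⟩ | ⟨c', hc', hsc, hle⟩
    · left
      by_cases hz' : z ∈ PSyz'
      · exact ⟨z, Or.inl hz', hzc⟩
      -- A discarded syzygy is replaced by one whose signature divides its own; for syzygies,
      -- divisibility suffices to rewrite.
      · obtain ⟨w, hw, hwz⟩ := hdvd z hz hz'
        obtain ⟨p, q, hp, hq, a, rfl⟩ := hwz
        obtain ⟨-, q', r, -, hq', hr, -⟩ := id hzc
        obtain rfl : p.shift a = q' := by rwa [hq, WithBot.coe_inj] at hq'
        refine ⟨w, Or.inl hw, ?_⟩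
        rw [tsRewrites_iff hq hr] at hzc
        rw [tsRewrites_iff hp hr]
        obtain ⟨⟨b, rfl⟩, hlt⟩ := hzc
        refine ⟨⟨b + a, (ModMon.shift_shift _ _ _).symm⟩, ?_⟩
        rw [(h.syzygy z hz).2, deg_zero, WithBot.bot_add, bot_lt_iff_ne_bot, Ne,
          WithBot.add_eq_bot, not_or] at hlt
        rw [(hsyz w hw).2, deg_zero, WithBot.bot_add, bot_lt_iff_ne_bot, Ne,
          WithBot.add_eq_bot, not_or]
        exact ⟨hlt.1, WithBot.coe_ne_bot⟩
    · exact Or.inl ⟨z, Or.inr ((hmem z).2 (Or.inr hz)), hzc⟩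
    · have hcSG : c.fst ∈ SG := by rwa [hfst]
      by_cases he : c' = cp
      · subst he
        exact Or.inl (h.tsRewritable_of_idxOf_le hcSG (h.fst_mem hc') hsc hle
          ⟨sp, Or.inr ((hmem sp).2 (Or.inl rfl)), tsRewrites_of_deg_lt hsig hT hdeg⟩)
      · obtain ⟨c'', hc'', hsc', hle'⟩ := hold c' (Finset.mem_erase.2 ⟨he, hc'⟩)
        refine Or.inr ⟨c'', hc'', hsc'.trans hsc, le_trans ?_ hle'⟩
        have hc'SG := h.fst_mem hc'
        rw [hSG']
        rw [hl] at hspSG hcSG hc'SG hle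
        exact idxOf_le_idxOf_insert hspSG hcSG hc'SG hle

lemma insertByDecreasingL_perm (SG : List (SigPoly K n d)) (hdesc : Descending m o SG)
    (sp : SigPoly K n d) : (insertByDecreasingL m o sp SG).Perm (sp :: SG) := by
  obtain ⟨l₁, l₂, rfl, hl, -⟩ := insertByDecreasingL_spec hdesc sp
  rw [hl]
  exact List.perm_middle

open scoped Classical in
lemma Inv.insert_syzygy (h : Inv m o f A CPs SG PSyz) {cp : JPair K n d} (hcp : cp ∈ CPs)
    (hts : ¬ TsRewritable m o ((PSyz : Set (SigPoly K n d)) ∪ {x : SigPoly K n d | x ∈ SG})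
      cp.toSigPoly)
    (hrep : Represents f A sp) (hsig : sig o sp = sig o cp.toSigPoly)
    (hdeg : deg m sp.poly < deg m cp.toSigPoly.poly) (hsp : sp.poly = 0) :
    Inv m o f A (CPs.erase cp) (insertByDecreasingL m o sp SG) PSyz := by
  have hmem : ∀ x ∈ SG, x ∈ insertByDecreasingL m o sp SG := fun x hx =>
    (insertByDecreasingL_perm SG h.descending sp).mem_iff.2 (List.mem_cons_of_mem _ hx)
  refine h.insert hcp hts hrep hsig hdeg rfl h.syzygy (fun z hz hz' => absurd hz hz') ?_ ?_
    (fun c hc => ⟨c, hc, rfl, le_rfl⟩) fun _ _ _ _ h0 => absurd hsp h0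
  · intro c hc
    obtain ⟨x, hx, y, hy, hxy⟩ := h.pair c (Finset.mem_of_mem_erase hc)
    exact ⟨x, hmem x hx, y, hmem y hy, hxy⟩
  · exact fun c hc c' hc' => h.unique c (Finset.mem_of_mem_erase hc) c'
      (Finset.mem_of_mem_erase hc')

open scoped Classical in
lemma exists_mem_storeOne {c : JPair K n d} (hc : c ∈ CPs) :
    ∃ c' ∈ storeOne o SG CPs, sig o c'.toSigPoly = sig o c.toSigPoly ∧
      SG.idxOf c.fst ≤ SG.idxOf c'.fst := by
  have hc₀ : c ∈ CPs.filter fun c' => sig o c'.toSigPoly = sig o c.toSigPoly :=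
    Finset.mem_filter.2 ⟨hc, rfl⟩
  obtain ⟨c', hc', hmax⟩ := Finset.exists_max_image _ (fun c' => SG.idxOf c'.fst) ⟨c, hc₀⟩
  rw [Finset.mem_filter] at hc'
  refine ⟨c', ?_, hc'.2, hmax c hc₀⟩
  rw [storeOne, Finset.mem_filter]
  exact ⟨hc'.1, fun c'' hc'' hs => hmax c'' (Finset.mem_filter.2 ⟨hc'', hs.trans hc'.2⟩)⟩

/-- Two stored pairs of equal signature have equally late, hence equal, first components; the
signature then determines the multiplier. -/
lemma eq_of_mem_storeOne {c c' : JPair K n d} (hc : c ∈ storeOne o SG CPs)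
    (hc' : c' ∈ storeOne o SG CPs) (hmem : c.fst ∈ SG) {s : ModMon n d}
    (hs : sig o c.fst = s) (hsig : sig o c.toSigPoly = sig o c'.toSigPoly) : c = c' := by
  classical
  rw [storeOne, Finset.mem_filter] at hc hc'
  have hle := hc.2 c' hc'.1 hsig.symm
  have hle' := hc'.2 c hc.1 hsig
  have hfst : c.fst = c'.fst := (List.idxOf_inj hmem).1 (le_antisymm hle' hle)
  rw [sig_toSigPoly c hs, sig_toSigPoly c' (hfst ▸ hs), WithBot.coe_inj] at hsig
  exact JPair.ext (s.shift_right_injective hsig) hfst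

open scoped Classical in
lemma Inv.insert_nonsyzygy (h : Inv m o f A CPs SG PSyz) {cp : JPair K n d} (hcp : cp ∈ CPs)
    (hts : ¬ TsRewritable m o ((PSyz : Set (SigPoly K n d)) ∪ {x : SigPoly K n d | x ∈ SG})
      cp.toSigPoly)
    (hrep : Represents f A sp) (hsig : sig o sp = sig o cp.toSigPoly)
    (hdeg : deg m sp.poly < deg m cp.toSigPoly.poly) {SG' : List (SigPoly K n d)}
    (hSG' : SG' = insertByDecreasingL m o sp SG) {PSyz' : Finset (SigPoly K n d)}
    (hPSyz' : DiscardSuper o (PSyz ∪ newPSyz sp SG') PSyz') :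
    Inv m o f A (storeOne o SG' (CPs.erase cp ∪ newJPairs m o sp SG')) SG' PSyz' := by
  have hmem : ∀ x, x ∈ SG' ↔ x = sp ∨ x ∈ SG := by
    intro x
    rw [hSG', (insertByDecreasingL_perm SG h.descending sp).mem_iff, List.mem_cons]
  have hmemJ : ∀ c, c ∈ newJPairs m o sp SG' ↔
      ∃ x ∈ SG', x ≠ sp ∧ x.poly ≠ 0 ∧ c ∈ jPair m o sp x := by
    intro c
    simp only [newJPairs, nonSyz, Finset.mem_biUnion, Finset.mem_erase, Finset.mem_filter,
      List.mem_toFinset]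
    exact ⟨fun ⟨x, ⟨h1, h2, h3⟩, h4⟩ => ⟨x, h2, h1, h3, h4⟩,
      fun ⟨x, h2, h1, h3, h4⟩ => ⟨x, ⟨h1, h2, h3⟩, h4⟩⟩
  have hpair : ∀ c ∈ CPs.erase cp ∪ newJPairs m o sp SG',
      ∃ x ∈ SG', ∃ y ∈ SG', c ∈ jPairFst m o x y := by
    intro c hc
    rcases Finset.mem_union.1 hc with hc | hc
    · obtain ⟨x, hx, y, hy, hxy⟩ := h.pair c (Finset.mem_of_mem_erase hc)
      exact ⟨x, (hmem x).2 (Or.inr hx), y, (hmem y).2 (Or.inr hy), hxy⟩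
    · obtain ⟨x, hx, -, -, hxc⟩ := (hmemJ c).1 hc
      have hsp : sp ∈ SG' := (hmem sp).2 (Or.inl rfl)
      rcases mem_jPair.1 hxc with hxc | hxc
      · exact ⟨sp, hsp, x, hx, hxc⟩
      · exact ⟨x, hx, sp, hsp, hxc⟩
  have hsub : ∀ c ∈ storeOne o SG' (CPs.erase cp ∪ newJPairs m o sp SG'),
      c ∈ CPs.erase cp ∪ newJPairs m o sp SG' := fun c hc => (Finset.mem_filter.1 hc).1
  have hrep' : ∀ x ∈ SG', Represents f A x := by
    intro x hx
    rcases (hmem x).1 hx with rfl | hx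
    · exact hrep
    · exact h.represents x hx
  refine h.insert hcp hts hrep hsig hdeg hSG' ?_ ?_ (fun c hc => hpair c (hsub c hc)) ?_
    (fun c hc => exists_mem_storeOne (Finset.mem_union_left _ hc))
    fun x hx hxsp hx0 _ c hc => exists_mem_storeOne
      (Finset.mem_union_right _ ((hmemJ c).2 ⟨x, hx, hxsp, hx0, hc⟩))
  · intro z hz
    rcases Finset.mem_union.1 (hPSyz'.1 hz) with hz | hz
    · exact h.syzygy z hz
    · simp only [newPSyz, nonSyz, Finset.mem_filter, Finset.mem_image, List.mem_toFinset] at hz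
      obtain ⟨⟨x, ⟨hx, -⟩, rfl⟩, -⟩ := hz
      exact ⟨hrep.principalSyz (hrep' x hx), rfl⟩
  · exact fun z hz hz' => hPSyz'.2.1 z (Finset.mem_union_left _ hz) hz'
  · intro c hc c' hc' hcc'
    obtain ⟨x, hx, y, -, hxy⟩ := hpair c (hsub c hc)
    obtain ⟨s, -, -, hs, -⟩ := mem_jPairFst_sup hxy
    have hfst := fst_eq_of_mem_jPairFst hxy
    exact eq_of_mem_storeOne hc hc' (hfst.symm ▸ hx) (by rw [hfst, hs]) hcc'

/-! ### Initialization -/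

lemma sig_initPair (Q : List (MvPolynomial (Fin n) K)) (h : Q.length ≤ d) (i : Fin Q.length) :
    sig o (initPair Q h i) = (⟨0, Fin.castLE h i⟩ : ModMon n d) :=
  o.leadMon_single _

/-- The family is padded by zeros outside `A`. The initial signatures have distinct indices, so a
J-pair signature determines its first component, and each J-pair covers itself. -/
lemma inv_init (Q : List (MvPolynomial (Fin n) K)) (h : Q.length ≤ d) :
    ∃ (f : Fin d → MvPolynomial (Fin n) K) (A : Set (Fin d)), f '' A = {q | q ∈ Q} ∧
      Inv m o f A (initCPs m o Q h) (initSG Q h) (initPSyz Q h) := by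
  classical
  set f : Fin d → MvPolynomial (Fin n) K :=
    fun i => if hi : i.1 < Q.length then Q.get ⟨i.1, hi⟩ else 0
  have hf : ∀ i : Fin Q.length, f (Fin.castLE h i) = Q.get i := fun i => by simp [f]
  set A : Set (Fin d) := Set.range (Fin.castLE h)
  have hmem : ∀ x, x ∈ initSG Q h ↔ ∃ i, initPair Q h i = x := fun x => by
    simp [initSG, List.mem_ofFn]
  have hrep : ∀ i, Represents f A (initPair Q h i) := by
    refine fun i => ⟨?_, fun j hj => ?_⟩
    · rw [Finset.sum_eq_single (Fin.castLE h i)]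
      · simp [initPair, hf]
      · intro j _ hj
        simp [initPair, hj]
      · simp
    · have : j ≠ Fin.castLE h i := by rintro rfl; exact hj ⟨i, rfl⟩
      simp [initPair, this]
  have hinj : ∀ i j, (⟨0, Fin.castLE h i⟩ : ModMon n d).idx = (⟨0, Fin.castLE h j⟩ : ModMon n d).idx
      → i = j := fun i j hij => Fin.castLE_injective h hij
  have hpairinj : Function.Injective (initPair Q h) := by
    intro i j hij
    have := congrArg (sig o) hij
    rw [sig_initPair, sig_initPair, WithBot.coe_inj] at this
    exact hinj i j (congrArg ModMon.idx this)
  have hpair : ∀ c, c ∈ initCPs m o Q h ↔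
      ∃ i j, c ∈ jPairFst m o (initPair Q h i) (initPair Q h j) := by
    intro c
    simp only [initCPs, Finset.mem_biUnion, Finset.mem_filter, Finset.mem_univ, true_and,
      mem_jPair, Prod.exists]
    constructor
    · rintro ⟨i, j, -, hc | hc⟩
      · exact ⟨i, j, hc⟩
      · exact ⟨j, i, hc⟩
    · rintro ⟨i, j, hc⟩
      rcases lt_trichotomy i j with hij | rfl | hij
      · exact ⟨i, j, hij, Or.inl hc⟩
      · exact absurd rfl (ne_of_mem_jPairFst hc)
      · exact ⟨j, i, hij, Or.inr hc⟩
  refine ⟨f, A, ?_, ⟨?_, ?_, ?_, ?_, ?_, ?_, ?_, ?_, ?_⟩⟩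
  · ext q
    simp only [A, ← Set.range_comp, Set.mem_range, Function.comp_apply, hf, Set.mem_ofPred_eq,
      List.mem_iff_get]
  · exact List.nodup_ofFn.2 hpairinj
  · rw [Descending, initSG, List.pairwise_ofFn]
    intro i j hij hsame
    rw [sameIdx_iff (sig_initPair Q h i) (sig_initPair Q h j)] at hsame
    exact absurd (hinj i j hsame) hij.ne
  · intro x hx
    obtain ⟨i, rfl⟩ := (hmem x).1 hx
    exact hrep i
  · intro x hx
    obtain ⟨i, rfl⟩ := (hmem x).1 hx
    exact ⟨_, sig_initPair Q h i⟩
  · rintro _ ⟨i, rfl⟩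
    exact ⟨_, (hmem _).2 ⟨i, rfl⟩, sig_initPair Q h i, (hf i).symm⟩
  · intro z hz
    simp only [initPSyz, Finset.mem_image, Prod.exists] at hz
    obtain ⟨i, j, -, rfl⟩ := hz
    exact ⟨(hrep i).principalSyz (hrep j), rfl⟩
  · intro c hc
    obtain ⟨i, j, hc⟩ := (hpair c).1 hc
    exact ⟨_, (hmem _).2 ⟨i, rfl⟩, _, (hmem _).2 ⟨j, rfl⟩, hc⟩
  · intro c hc c' hc' hsig
    obtain ⟨i, _, hc⟩ := (hpair c).1 hc
    obtain ⟨i', _, hc'⟩ := (hpair c').1 hc'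
    have hi := fst_eq_of_mem_jPairFst hc
    have hi' := fst_eq_of_mem_jPairFst hc'
    have hs := sig_initPair (o := o) Q h i
    have hs' := sig_initPair (o := o) Q h i'
    rw [← hi] at hs
    rw [← hi'] at hs'
    rw [sig_toSigPoly c hs, sig_toSigPoly c' hs', WithBot.coe_inj] at hsig
    obtain rfl := hinj i i' (congrArg ModMon.idx hsig.symm).symm
    exact JPair.ext (ModMon.shift_right_injective _ hsig) (hi.trans hi'.symm)
  · intro x hx y hy c hc
    obtain ⟨i, rfl⟩ := (hmem x).1 hx
    obtain ⟨j, rfl⟩ := (hmem y).1 hy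
    exact Or.inr ⟨c, (hpair c).2 ⟨i, j, hc⟩, rfl, le_rfl⟩

end

section

variable {K : Type*} [Field K] {n d : ℕ} {m : MonomialOrder (Fin n)} {o : ModuleOrder n d}

/-! ### Interreduction and sorting -/

lemma InterreduceStep.length_le {P P' : List (MvPolynomial (Fin n) K)}
    (h : InterreduceStep m P P') : P'.length ≤ P.length := by
  cases h <;> simp

lemma InterreduceStep.span_eq {P P' : List (MvPolynomial (Fin n) K)}
    (h : InterreduceStep m P P') : Ideal.span {p | p ∈ P'} = Ideal.span {p | p ∈ P} := by
  cases h with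
  | drop l₁ l₂ =>
    refine le_antisymm (Ideal.span_mono fun p hp => ?_) (Ideal.span_le.2 fun p hp => ?_)
    · simp only [Set.mem_ofPred_eq, List.mem_append, List.mem_cons] at hp ⊢
      tauto
    · simp only [Set.mem_ofPred_eq, List.mem_append, List.mem_cons] at hp
      by_cases h0 : p = 0
      · rw [h0]
        exact Ideal.zero_mem _
      · exact Ideal.subset_span (by simpa [h0] using hp)
  | cancel l₁ l₂ f g a hg hg0 ha hdvd =>
    set h := monomial (a - m.degree g) (f.coeff a / m.leadingCoeff g)
    have hmem : ∀ (q : MvPolynomial (Fin n) K), ∀ p ∈ l₁ ++ l₂,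
        p ∈ Ideal.span {p | p ∈ l₁ ++ q :: l₂} := by
      intro q p hp
      refine Ideal.subset_span ?_
      simp only [Set.mem_ofPred_eq, List.mem_append, List.mem_cons] at hp ⊢
      tauto
    have hq : ∀ q : MvPolynomial (Fin n) K, q ∈ Ideal.span {p | p ∈ l₁ ++ q :: l₂} :=
      fun q => Ideal.subset_span (by simp)
    -- Exchanging one entry for a member of the span does not enlarge the span; this is applied in
    -- both directions.
    have hle : ∀ q q' : MvPolynomial (Fin n) K, q ∈ Ideal.span {p | p ∈ l₁ ++ q' :: l₂} →
        Ideal.span {p | p ∈ l₁ ++ q :: l₂} ≤ Ideal.span {p | p ∈ l₁ ++ q' :: l₂} := by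
      refine fun q q' hqq' => Ideal.span_le.2 fun p hp => ?_
      by_cases hpq : p = q
      · rwa [hpq]
      · refine hmem q' p ?_
        simp only [Set.mem_ofPred_eq, List.mem_append, List.mem_cons] at hp ⊢
        tauto
    refine le_antisymm (hle _ _ ?_) (hle _ _ ?_)
    · exact Ideal.sub_mem _ (hq f) (Ideal.mul_mem_left _ _ (hmem _ g hg))
    · have := Ideal.add_mem _ (hq (f - h * g))
        (Ideal.mul_mem_left _ h (hmem (f - h * g) g hg))
      rwa [sub_add_cancel] at this

lemma SortedListing.length_eq {P Q : List (MvPolynomial (Fin n) K)} (h : SortedListing m P Q) :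
    Q.length = P.length := by
  obtain ⟨⟨P', hP, hQ⟩, -⟩ := h
  rw [← hQ.length_eq, hP.length_eq]

lemma SortedListing.span_eq {P Q : List (MvPolynomial (Fin n) K)} (h : SortedListing m P Q) :
    Ideal.span {q | q ∈ Q} = Ideal.span {p | p ∈ P} := by
  obtain ⟨⟨P', hP, hQ⟩, -⟩ := h
  have hPP' : {p | p ∈ P} = {p | p ∈ P'} := Set.ext fun p => hP.mem_iff.symm
  rw [hPP']
  clear hP hPP'
  induction hQ with
  | nil => rfl
  | @cons p q P' Q hpq _ ih =>
    obtain ⟨c, hc, rfl⟩ := hpq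
    have hset : ∀ (r : MvPolynomial (Fin n) K) (l : List (MvPolynomial (Fin n) K)),
        {p | p ∈ r :: l} = insert r {p | p ∈ l} := fun r l => by ext; simp
    rw [hset, hset, Ideal.span_insert, Ideal.span_insert, ih,
      Ideal.span_singleton_mul_left_unit]
    exact (Ne.isUnit hc).map C

lemma exists_sortedListing (m : MonomialOrder (Fin n)) (P : List (MvPolynomial (Fin n) K)) :
    ∃ Q, SortedListing m P Q := by
  classical
  let r : MvPolynomial (Fin n) K → MvPolynomial (Fin n) K → Prop :=
    fun f g => m.toSyn (m.degree f) ≤ m.toSyn (m.degree g)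
  have : Std.Total r := ⟨fun f g => le_total _ _⟩
  have : IsTrans _ r := ⟨fun f g h => le_trans⟩
  exact ⟨P.insertionSort r, ⟨_, P.perm_insertionSort r,
    List.forall₂_same.2 fun p _ => ⟨1, one_ne_zero, by simp⟩⟩, P.pairwise_insertionSort r⟩

/-- The multiset of all monomials that occur in the polynomials of a list. -/
noncomputable def monomials (m : MonomialOrder (Fin n)) (P : List (MvPolynomial (Fin n) K)) :
    Multiset m.syn :=
  (P.map fun p => p.support.val.map m.toSyn).sum

/-- Cancelling at `a` keeps the monomials of `f` above `a`, removes `a`, and changes only smaller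
ones, which decreases the multiset order. Deleting a zero keeps the multiset and shortens the list.
-/
lemma InterreduceStep.lex {P P' : List (MvPolynomial (Fin n) K)} (h : InterreduceStep m P P') :
    Prod.Lex Multiset.IsDershowitzMannaLT (· < ·) (monomials m P', P'.length)
      (monomials m P, P.length) := by
  classical
  cases h with
  | drop l₁ l₂ =>
    have : monomials m (l₁ ++ l₂) = monomials m (l₁ ++ 0 :: l₂) := by simp [monomials]
    rw [this]
    exact Prod.Lex.right _ (by simp)
  | cancel l₁ l₂ f g a hg hg0 ha hdvd =>
    refine Prod.Lex.left _ _ ?_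
    set f' := f - monomial (a - m.degree g) (f.coeff a / m.leadingCoeff g) * g with hf'
    have hg' := m.leadingCoeff_ne_zero_iff.2 hg0
    have hfa : f.coeff a ≠ 0 := by simpa using ha
    have hdeg : deg m (monomial (a - m.degree g) (f.coeff a / m.leadingCoeff g) * g) =
        (m.toSyn a : m.syn) := by
      rw [deg_monomial_mul m _ (div_ne_zero hfa hg'), deg_eq_coe m hg0, ← WithBot.coe_add,
        ← map_add, tsub_add_cancel_of_le hdvd]
    have hcoeff : ∀ b, m.toSyn a < m.toSyn b → f'.coeff b = f.coeff b := by
      intro b hb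
      rw [hf', coeff_sub, sub_eq_self]
      by_contra h0
      have := le_deg m h0
      rw [hdeg, WithBot.coe_le_coe] at this
      exact this.not_gt hb
    have hcoeffa : f'.coeff a = 0 := by
      rw [hf', coeff_sub, sub_eq_zero]
      have := coeff_monomial_mul (m.degree g) (a - m.degree g) (f.coeff a / m.leadingCoeff g) g
      rw [tsub_add_cancel_of_le hdvd] at this
      rw [this]
      exact (div_mul_cancel₀ _ hg').symm
    have hsplit : ∀ q : MvPolynomial (Fin n) K, q.support.val.map m.toSyn =
        (q.support.filter fun b => m.toSyn a < m.toSyn b).val.map m.toSyn +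
        (q.support.filter fun b => ¬ m.toSyn a < m.toSyn b).val.map m.toSyn := by
      intro q
      rw [Finset.filter_val, Finset.filter_val, ← Multiset.map_add, Multiset.filter_add_not]
    have heq : (f'.support.filter fun b => m.toSyn a < m.toSyn b) =
        f.support.filter fun b => m.toSyn a < m.toSyn b := by
      ext b
      simp only [Finset.mem_filter, mem_support_iff, and_congr_left_iff]
      exact fun hb => by rw [hcoeff b hb]
    refine ⟨(monomials m l₁ + monomials m l₂) +
        (f.support.filter fun b => m.toSyn a < m.toSyn b).val.map m.toSyn,
      (f'.support.filter fun b => ¬ m.toSyn a < m.toSyn b).val.map m.toSyn,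
      (f.support.filter fun b => ¬ m.toSyn a < m.toSyn b).val.map m.toSyn, ?_, ?_, ?_, ?_⟩
    · have : m.toSyn a ∈
          (f.support.filter fun b => ¬ m.toSyn a < m.toSyn b).val.map m.toSyn :=
        Multiset.mem_map_of_mem _ (by simpa using hfa)
      intro h0
      rw [h0] at this
      exact absurd this (Multiset.notMem_zero _)
    · rw [add_assoc, ← heq, ← hsplit, monomials, monomials, monomials, List.map_append,
        List.map_cons, List.sum_append, List.sum_cons, add_right_comm, add_assoc]
    · rw [add_assoc, ← hsplit, monomials, monomials, monomials, List.map_append,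
        List.map_cons, List.sum_append, List.sum_cons, add_right_comm, add_assoc]
    · intro y hy
      simp only [Multiset.mem_map, Finset.mem_val, Finset.mem_filter, mem_support_iff] at hy
      obtain ⟨b, ⟨hb, hba⟩, rfl⟩ := hy
      refine ⟨m.toSyn a, Multiset.mem_map_of_mem _ (by simpa using hfa), ?_⟩
      refine lt_of_le_of_ne (not_lt.1 hba) fun e => hb ?_
      rw [m.toSyn.injective e, hcoeffa]

/-! ### Discarding syzygies -/

lemma SigDivides.trans {x y z : SigPoly K n d} (h : SigDivides o x y) (h' : SigDivides o y z) :
    SigDivides o x z := by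
  obtain ⟨s, t, hs, ht, a, rfl⟩ := h
  obtain ⟨t', r, ht', hr, b, rfl⟩ := h'
  rw [ht, WithBot.coe_inj] at ht'
  subst ht'
  exact ⟨s, _, hs, hr, b + a, (ModMon.shift_shift _ _ _).symm⟩

/-- Add the syzygies one at a time: skip the new one if a kept one divides it, otherwise keep it and
remove those it divides. -/
lemma exists_discardSuper (o : ModuleOrder n d) (A : Finset (SigPoly K n d)) :
    ∃ B, DiscardSuper o A B := by
  classical
  induction A using Finset.induction_on with
  | empty => exact ⟨∅, by simp [DiscardSuper]⟩
  | insert z A hz ih =>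
    obtain ⟨B, hBA, hcov, hanti⟩ := ih
    by_cases hB : ∃ y ∈ B, SigDivides o y z
    · refine ⟨B, hBA.trans (Finset.subset_insert _ _), fun w hw hwB => ?_, hanti⟩
      rcases Finset.mem_insert.1 hw with rfl | hw
      · exact hB
      · exact hcov w hw hwB
    · push Not at hB
      refine ⟨insert z (B.filter fun y => ¬ SigDivides o z y), ?_, ?_, ?_⟩
      · exact Finset.insert_subset_insert _ ((Finset.filter_subset _ _).trans hBA)
      · intro w hw hwB
        simp only [Finset.mem_insert, Finset.mem_filter, not_or, not_and, not_not] at hw hwB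
        rcases hw with rfl | hw
        · exact absurd rfl hwB.1
        by_cases hwB' : w ∈ B
        · exact ⟨z, Finset.mem_insert_self _ _, hwB.2 hwB'⟩
        · obtain ⟨y, hy, hyw⟩ := hcov w hw hwB'
          by_cases hzy : SigDivides o z y
          · exact ⟨z, Finset.mem_insert_self _ _, hzy.trans hyw⟩
          · exact ⟨y, Finset.mem_insert_of_mem (Finset.mem_filter.2 ⟨hy, hzy⟩), hyw⟩
      · intro y hy w hw hyw
        simp only [Finset.mem_insert, Finset.mem_filter] at hy hw
        rcases hy with rfl | hy <;> rcases hw with rfl | hw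
        · exact absurd rfl hyw
        · exact hw.2
        · exact hB y hy.1
        · exact hanti y hy.1 w hw.1 hyw

lemma exists_isMinPair (o : ModuleOrder n d) {CPs : Finset (JPair K n d)} (hne : CPs.Nonempty) :
    ∃ cp, IsMinPair o CPs cp := by
  let := o.toLinearOrder
  obtain ⟨cp, hcp, hmin⟩ := Finset.exists_min_image CPs (fun cp => sig o cp.toSigPoly) hne
  refine ⟨cp, hcp, fun cp' hcp' s t hs ht => ?_⟩
  have := hmin cp' hcp'
  rw [hs, ht] at this
  exact WithBot.coe_le_coe.1 this

/-! ### Runs of the algorithm -/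

/-- The invariant that holds while the J-pair `cp` is being top-reduced and `cur` is its current
value. -/
structure ReduceInv (m : MonomialOrder (Fin n)) (o : ModuleOrder n d)
    (f : Fin d → MvPolynomial (Fin n) K) (A : Set (Fin d)) (cp : JPair K n d)
    (cur : SigPoly K n d) (CPs : Finset (JPair K n d)) (SG : List (SigPoly K n d))
    (PSyz : Finset (SigPoly K n d)) : Prop where
  inv : Inv m o f A CPs SG PSyz
  mem : cp ∈ CPs
  not_tsRewritable : ¬ TsRewritable m o
    ((PSyz : Set (SigPoly K n d)) ∪ {x : SigPoly K n d | x ∈ SG}) cp.toSigPoly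
  represents : Represents f A cur
  sig_eq : sig o cur = sig o cp.toSigPoly
  eq_or_lt : cur = cp.toSigPoly ∨ deg m cur.poly < deg m cp.toSigPoly.poly

/-! ### Top-reduction of a chosen J-pair -/

section ReduceInv

variable {f : Fin d → MvPolynomial (Fin n) K} {A : Set (Fin d)} {cp : JPair K n d}
  {cur : SigPoly K n d} {CPs : Finset (JPair K n d)} {SG : List (SigPoly K n d)}
  {PSyz : Finset (SigPoly K n d)}

lemma ReduceInv.tmReduces (h : ReduceInv m o f A cp cur CPs SG PSyz) {cur' : SigPoly K n d}
    (hred : TmReduces m o SG cur cur') : ReduceInv m o f A cp cur' CPs SG PSyz := by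
  obtain ⟨x, hx, hred⟩ := hred
  refine ⟨h.inv, h.mem, h.not_tsRewritable, hred.represents (h.inv.represents x hx) h.represents,
    hred.sig_eq.trans h.sig_eq, Or.inr ?_⟩
  rcases h.eq_or_lt with rfl | hlt
  · exact hred.deg_lt
  · exact hred.deg_lt.trans hlt

/-- A J-pair is top-reducible, so its top-reduction lowers the leading monomial. -/
lemma ReduceInv.deg_lt (h : ReduceInv m o f A cp cur CPs SG PSyz)
    (hirr : ∀ z, ¬ TmReduces m o SG cur z) : deg m cur.poly < deg m cp.toSigPoly.poly := by
  rcases h.eq_or_lt with rfl | hlt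
  · exfalso
    obtain ⟨x, hx, y, hy, hxy⟩ := h.inv.pair cp h.mem
    obtain ⟨s, t, b, hs, ht, hx0, hy0, rfl, hb, hlt⟩ := mem_jPairFst_sup hxy
    have h0 : cp.toSigPoly.poly ≠ 0 := by
      simp [JPair.toSigPoly, SigPoly.termMul, hx0]
    have hdeg := deg_toSigPoly (m := m) cp
    rw [deg_eq_coe m h0, deg_eq_coe m hx0, ← WithBot.coe_add, ← map_add, WithBot.coe_inj,
      m.toSyn.injective.eq_iff] at hdeg
    -- The second component `y`, with cofactor `b`, reduces the unreduced J-pair.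
    obtain ⟨z, hz⟩ := exists_tmReducesBy hy0 h0 ht (sig_toSigPoly cp hs) (hb.trans hdeg.symm) hlt
    exact hirr z ⟨y, hy, hz⟩
  · exact hlt

end ReduceInv

open scoped Classical in
/-- The invariant of the states of a run on generators of `I`. -/
def StateInv (m : MonomialOrder (Fin n)) (o : ModuleOrder n d)
    (I : Ideal (MvPolynomial (Fin n) K)) : State K n d → Prop
  | .interreduce P => P.length ≤ d ∧ Ideal.span {p | p ∈ P} = I
  | .loop CPs SG PSyz => ∃ f A, Ideal.span (f '' A) = I ∧ Inv m o f A CPs SG PSyz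
  | .reduce cur CPs SG PSyz => ∃ f A cp CPs₀, Ideal.span (f '' A) = I ∧ CPs = CPs₀.erase cp ∧
      ReduceInv m o f A cp cur CPs₀ SG PSyz
  | .halt G => IsGroebnerBasis m (G : Set (MvPolynomial (Fin n) K)) I

/-! ### Invariance along runs and absence of deadlock -/

variable {I : Ideal (MvPolynomial (Fin n) K)}

lemma Step.stateInv {S S' : State K n d} (h : Step m o S S') (hS : StateInv m o I S) :
    StateInv m o I S' := by
  classical
  cases h with
  | interreduce P P' hP => exact ⟨hP.length_le.trans hS.1, hP.span_eq.trans hS.2⟩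
  | init P Q hP hQ h =>
    obtain ⟨f, A, hfA, hinv⟩ := inv_init (m := m) (o := o) Q h
    exact ⟨f, A, by rw [hfA, hQ.span_eq, hS.2], hinv⟩
  | discard CPs SG PSyz cp hmin hcrit =>
    obtain ⟨f, A, hI, hinv⟩ := hS
    rw [hinv.passesCriteria_iff hmin, not_not] at hcrit
    exact ⟨f, A, hI, hinv.discard hmin.1 hcrit⟩
  | pass CPs SG PSyz cp hmin hcrit =>
    obtain ⟨f, A, hI, hinv⟩ := hS
    rw [hinv.passesCriteria_iff hmin] at hcrit
    -- The invariant keeps `cp` pending during its reduction, since its covering role passes on only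
    -- when the result is stored.
    exact ⟨f, A, cp, CPs, hI, rfl, hinv, hmin.1, hcrit,
      (hinv.represents _ (hinv.fst_mem hmin.1)).termMul _ _, rfl, Or.inl rfl⟩
  | tmReduce cur cur' CPs SG PSyz hred =>
    obtain ⟨f, A, cp, CPs₀, hI, hCPs, hinv⟩ := hS
    exact ⟨f, A, cp, CPs₀, hI, hCPs, hinv.tmReduces hred⟩
  | storeSyzygy sp CPs SG PSyz hirr hsp =>
    obtain ⟨f, A, cp, CPs₀, hI, rfl, hinv⟩ := hS
    exact ⟨f, A, hI, hinv.inv.insert_syzygy hinv.mem hinv.not_tsRewritable hinv.represents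
      hinv.sig_eq (hinv.deg_lt hirr) hsp⟩
  | store sp CPs SG SG' PSyz PSyz' hirr hsp hSG' hPSyz' =>
    obtain ⟨f, A, cp, CPs₀, hI, rfl, hinv⟩ := hS
    exact ⟨f, A, hI, hinv.inv.insert_nonsyzygy hinv.mem hinv.not_tsRewritable hinv.represents
      hinv.sig_eq (hinv.deg_lt hirr) hSG' hPSyz'⟩
  | halt SG PSyz =>
    obtain ⟨f, A, rfl, hinv⟩ := hS
    exact hinv.isGroebnerBasis_output

lemma stateInv_start (m : MonomialOrder (Fin n)) (o : ModuleOrder n d)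
    (F : Fin d → MvPolynomial (Fin n) K) :
    StateInv m o (Ideal.span (Set.range F)) (start F) := by
  refine ⟨by simp, congrArg _ (Set.ext fun p => ?_)⟩
  simp [List.mem_ofFn]

lemma Reachable.stateInv {F : Fin d → MvPolynomial (Fin n) K} {S : State K n d}
    (h : Reachable m o F S) : StateInv m o (Ideal.span (Set.range F)) S := by
  induction h with
  | refl => exact stateInv_start m o F
  | tail _ hstep ih => exact hstep.stateInv ih

lemma StateInv.exists_eq_halt {S : State K n d} (h : StateInv m o I S)
    (hS : ∀ S', ¬ Step m o S S') : ∃ G, S = .halt G := by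
  classical
  cases S with
  | interreduce P =>
    by_cases hP : Interreduced m P
    · obtain ⟨Q, hQ⟩ := exists_sortedListing m P
      exact absurd (Step.init P Q hP hQ (hQ.length_eq.trans_le h.1)) (hS _)
    · simp only [Interreduced, not_forall, not_not] at hP
      obtain ⟨P', hP⟩ := hP
      exact absurd (Step.interreduce P P' hP) (hS _)
  | loop CPs SG PSyz =>
    obtain ⟨f, A, hI, hinv⟩ := h
    rcases CPs.eq_empty_or_nonempty with rfl | hne
    · exact absurd (Step.halt SG PSyz) (hS _)
    · obtain ⟨cp, hmin⟩ := exists_isMinPair o hne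
      by_cases hcrit : PassesCriteria m o PSyz SG cp
      · exact absurd (Step.pass CPs SG PSyz cp hmin hcrit) (hS _)
      · exact absurd (Step.discard CPs SG PSyz cp hmin hcrit) (hS _)
  | reduce cur CPs SG PSyz =>
    by_cases hirr : ∀ z, ¬ TmReduces m o SG cur z
    · by_cases h0 : cur.poly = 0
      · exact absurd (Step.storeSyzygy cur CPs SG PSyz hirr h0) (hS _)
      · obtain ⟨PSyz', hPSyz'⟩ :=
          exists_discardSuper o (PSyz ∪ newPSyz cur (insertByDecreasingL m o cur SG))
        exact absurd (Step.store cur CPs SG _ PSyz PSyz' hirr h0 rfl hPSyz') (hS _)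
    · push Not at hirr
      obtain ⟨z, hz⟩ := hirr
      exact absurd (Step.tmReduce cur z CPs SG PSyz hz) (hS _)
  | halt G => exact ⟨G, rfl⟩

/-! ### Termination -/

/-- The sets that are closed upwards under a relation. -/
def UpClosed {α : Type*} (r : α → α → Prop) : Type _ :=
  {S : Set α // ∀ a b, r a b → a ∈ S → b ∈ S}

/-- Elements newly gained along a strictly ascending chain form a sequence in which, by
well-quasi-ordering, an earlier one lies below a later one; upward closure then puts the later one
into the chain too early. -/
lemma wellFounded_upClosed {α : Type*} {r : α → α → Prop} (hr : WellQuasiOrdered r) :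
    WellFounded fun S T : UpClosed r => T.1 ⊂ S.1 := by
  rw [wellFounded_iff_isEmpty_descending_chain]
  refine ⟨fun ⟨F, hF⟩ => ?_⟩
  choose x hx hx' using fun k => Set.exists_of_ssubset (hF k)
  obtain ⟨i, j, hij, h⟩ := hr x
  have hmono : Monotone fun k => (F k).1 := monotone_nat_of_le_succ fun k => (hF k).subset
  exact hx' j ((F j).2 _ _ h (hmono (Nat.succ_le_of_lt hij) (hx i)))

/-- Divisibility of leading pairs, given as index, whether the polynomial part is zero, and the
monomials of the signature and of the polynomial part. -/
def LeadPairLE (n d : ℕ) (v w : Fin d × Prop × (Fin n →₀ ℕ) × (Fin n →₀ ℕ)) : Prop :=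
  v.1 = w.1 ∧ v.2.1 = w.2.1 ∧ v.2.2.1 ≤ w.2.2.1 ∧ v.2.2.2 ≤ w.2.2.2

lemma wellQuasiOrdered_leadPairLE (n d : ℕ) : WellQuasiOrdered (LeadPairLE n d) :=
  (Finite.wellQuasiOrdered (α := Fin d) (· = ·)).prod
    ((Finite.wellQuasiOrdered (α := Prop) (· = ·)).prod
      ((wellQuasiOrdered_le (α := Fin n →₀ ℕ)).prod (wellQuasiOrdered_le (α := Fin n →₀ ℕ))))

/-- The multiples of leading pairs of elements of `SG`. -/
def leadPairs (m : MonomialOrder (Fin n)) (o : ModuleOrder n d) (SG : List (SigPoly K n d)) :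
    UpClosed (LeadPairLE n d) :=
  ⟨{v | ∃ x ∈ SG, ∃ s : ModMon n d, sig o x = s ∧
    LeadPairLE n d (s.idx, x.poly = 0, s.mon, m.degree x.poly) v}, by
    rintro v w ⟨h1, h2, h3, h4⟩ ⟨x, hx, s, hs, h1', h2', h3', h4'⟩
    exact ⟨x, hx, s, hs, h1'.trans h1, h2'.trans h2, h3'.trans h3, h4'.trans h4⟩⟩

/-- If the leading pair of `sp` were a multiple of that of `x`, with cofactors `a` for the signature
and `b` for the polynomial, then b < a would by compatibility let `x` tm-reduce `sp`, while a ≤ b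
makes `x` ts-rewrite `cp`. Both are excluded. -/
lemma ReduceInv.leadPairs_ssubset (hcomp : o.Compatible m)
    {f : Fin d → MvPolynomial (Fin n) K} {A : Set (Fin d)} {cp : JPair K n d}
    {sp : SigPoly K n d} {CPs : Finset (JPair K n d)} {SG : List (SigPoly K n d)}
    {PSyz : Finset (SigPoly K n d)} (h : ReduceInv m o f A cp sp CPs SG PSyz)
    (hirr : ∀ z, ¬ TmReduces m o SG sp z) :
    (leadPairs m o SG).1 ⊂ (leadPairs m o (insertByDecreasingL m o sp SG)).1 := by
  have hdeg := h.deg_lt hirr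
  obtain ⟨T, hT⟩ := h.inv.exists_sig_toSigPoly h.mem
  have hspT := h.sig_eq.trans hT
  have hmem : ∀ x, x ∈ insertByDecreasingL m o sp SG ↔ x = sp ∨ x ∈ SG := fun x => by
    rw [(insertByDecreasingL_perm SG h.inv.descending sp).mem_iff, List.mem_cons]
  rw [Set.ssubset_iff_of_subset]
  · refine ⟨(T.idx, sp.poly = 0, T.mon, m.degree sp.poly),
      ⟨sp, (hmem sp).2 (Or.inl rfl), T, hspT, rfl, rfl, le_rfl, le_rfl⟩, ?_⟩
    rintro ⟨x, hx, s, hs, hidx, h0, hmon, hle⟩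
    simp only at hidx h0 hmon hle
    set a := T.mon - s.mon with ha
    set b := m.degree sp.poly - m.degree x.poly with hb
    have haT : s.shift a = T := ModMon.ext (tsub_add_cancel_of_le hmon) hidx
    have hbx : b + m.degree x.poly = m.degree sp.poly := tsub_add_cancel_of_le hle
    refine h.not_tsRewritable ⟨x, Or.inr hx, fun hcp => ?_, s, T, a, hs, hT, haT, ?_⟩
    · rw [hcp, deg_zero] at hdeg
      exact not_lt_bot hdeg
    rw [map_add, m.toWithBotSyn_apply_coe]
    refine lt_of_le_of_lt ?_ hdeg
    change (m.toSyn a : WithBot m.syn) + deg m x.poly ≤ _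
    by_cases hx0 : x.poly = 0
    · rw [hx0, deg_zero, WithBot.add_bot]
      exact bot_le
    -- The zero flag is needed because `m.degree` does not separate the zero polynomial from
    -- constants.
    have hsp0 : sp.poly ≠ 0 := fun hp => hx0 (h0.mpr hp)
    rw [deg_eq_coe m hx0, deg_eq_coe m hsp0, ← hbx, map_add, WithBot.coe_add]
    gcongr
    rw [WithBot.coe_le_coe]
    by_contra hlt
    obtain ⟨z, hz⟩ := exists_tmReducesBy hx0 hsp0 hs hspT hbx
      (haT ▸ (hcomp.shift_lt_shift s).2 (not_le.1 hlt))
    exact hirr z ⟨x, hx, hz⟩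
  · rintro v ⟨x, hx, hv⟩
    exact ⟨x, (hmem x).2 (Or.inr hx), hv⟩

/-- A quantity that decreases in each step. -/
noncomputable def rank (m : MonomialOrder (Fin n)) (o : ModuleOrder n d) :
    State K n d → ℕ × (Multiset m.syn × ℕ) × (UpClosed (LeadPairLE n d) × ℕ × WithBot m.syn)
  | .interreduce P => (2, (monomials m P, P.length), (leadPairs (K := K) m o [], 0, ⊥))
  | .loop CPs SG _ => (1, (0, 0), (leadPairs m o SG, CPs.card, ⊥))
  | .reduce cur CPs SG _ => (1, (0, 0), (leadPairs m o SG, CPs.card, deg m cur.poly))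
  | .halt _ => (0, (0, 0), (leadPairs (K := K) m o [], 0, ⊥))

/-- The order for which `rank` decreases. -/
def RankLT (m : MonomialOrder (Fin n)) (d : ℕ) :
    ℕ × (Multiset m.syn × ℕ) × (UpClosed (LeadPairLE n d) × ℕ × WithBot m.syn) →
      ℕ × (Multiset m.syn × ℕ) × (UpClosed (LeadPairLE n d) × ℕ × WithBot m.syn) → Prop :=
  Prod.Lex (· < ·) (Prod.Lex (Prod.Lex Multiset.IsDershowitzMannaLT (· < ·))
    (Prod.Lex (fun S T => T.1 ⊂ S.1) (Prod.Lex (· < ·) (· < ·))))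

lemma wellFounded_rankLT (m : MonomialOrder (Fin n)) (d : ℕ) : WellFounded (RankLT m d) :=
  wellFounded_lt.prod_lex
    ((Multiset.wellFounded_isDershowitzMannaLT.prod_lex wellFounded_lt).prod_lex
    ((wellFounded_upClosed (wellQuasiOrdered_leadPairLE n d)).prod_lex
      (wellFounded_lt.prod_lex wellFounded_lt)))

/-- Storing enlarges the set of leading pairs, which outweighs any number of new J-pairs; choosing a
J-pair lowers the number pending, which outweighs the fresh leading monomial to be reduced. -/
lemma Step.rankLT (hcomp : o.Compatible m) {S S' : State K n d} (h : Step m o S S')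
    (hS : StateInv m o I S) : RankLT m d (rank m o S') (rank m o S) := by
  classical
  cases h with
  | interreduce P P' hP => exact Prod.Lex.right _ (Prod.Lex.left _ _ hP.lex)
  | init P Q hP hQ h => exact Prod.Lex.left _ _ one_lt_two
  | discard CPs SG PSyz cp hmin hcrit =>
    exact Prod.Lex.right _ (Prod.Lex.right _ (Prod.Lex.right _ (Prod.Lex.left _ _
      (Finset.card_erase_lt_of_mem hmin.1))))
  | pass CPs SG PSyz cp hmin hcrit =>
    exact Prod.Lex.right _ (Prod.Lex.right _ (Prod.Lex.right _ (Prod.Lex.left _ _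
      (Finset.card_erase_lt_of_mem hmin.1))))
  | tmReduce cur cur' CPs SG PSyz hred =>
    obtain ⟨x, -, hred⟩ := hred
    exact Prod.Lex.right _ (Prod.Lex.right _ (Prod.Lex.right _ (Prod.Lex.right _ hred.deg_lt)))
  | storeSyzygy sp CPs SG PSyz hirr hsp =>
    obtain ⟨f, A, cp, CPs₀, hI, -, hinv⟩ := hS
    exact Prod.Lex.right _ (Prod.Lex.right _ (Prod.Lex.left _ _
      (hinv.leadPairs_ssubset hcomp hirr)))
  | store sp CPs SG SG' PSyz PSyz' hirr hsp hSG' hPSyz' =>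
    obtain ⟨f, A, cp, CPs₀, hI, -, hinv⟩ := hS
    subst hSG'
    exact Prod.Lex.right _ (Prod.Lex.right _ (Prod.Lex.left _ _
      (hinv.leadPairs_ssubset hcomp hirr)))
  | halt SG PSyz => exact Prod.Lex.left _ _ one_pos

end

end F5G

theorem mainTheorem6 {K : Type*} [Field K] {n d : ℕ} (m : MonomialOrder (Fin n))
    (o : F5G.ModuleOrder n d) (hcomp : o.Compatible m)
    (F : Fin d → MvPolynomial (Fin n) K) :
    -- every run on the input `F` is finite
    (¬ ∃ run : ℕ → F5G.State K n d, run 0 = F5G.start F ∧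
      ∀ i : ℕ, F5G.Step m o (run i) (run (i + 1))) ∧
    -- a run ends only by halting, and then with a Gröbner basis of the ideal generated by `F`
    (∀ S : F5G.State K n d, F5G.Reachable m o F S → (∀ S' : F5G.State K n d, ¬ F5G.Step m o S S') →
      ∃ G : Finset (MvPolynomial (Fin n) K), S = .halt G ∧
        F5G.IsGroebnerBasis m (G : Set (MvPolynomial (Fin n) K)) (Ideal.span (Set.range F))) ∧
    -- whenever a J-pair is chosen, it passes the criteria iff it is not ts-rewritable
    (∀ (CPs : Finset (F5G.JPair K n d)) (SG : List (F5G.SigPoly K n d))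
      (PSyz : Finset (F5G.SigPoly K n d)) (cp : F5G.JPair K n d),
      F5G.Reachable m o F (.loop CPs SG PSyz) → F5G.IsMinPair o CPs cp →
      (F5G.PassesCriteria m o PSyz SG cp ↔
        ¬ F5G.TsRewritable m o
          ((PSyz : Set (F5G.SigPoly K n d)) ∪ {x : F5G.SigPoly K n d | x ∈ SG})
          cp.toSigPoly)) := by
  refine ⟨?_, ?_, ?_⟩
  · rintro ⟨run, h0, hstep⟩
    have hreach : ∀ i, F5G.StateInv m o (Ideal.span (Set.range F)) (run i) := by
      intro i
      induction i with
      | zero => rw [h0]; exact F5G.stateInv_start m o F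
      | succ i ih => exact (hstep i).stateInv ih
    -- An infinite run would give an infinite descending chain of ranks.
    exact (wellFounded_iff_isEmpty_descending_chain.1 (F5G.wellFounded_rankLT m d)).elim
      ⟨fun i => F5G.rank m o (run i), fun i => (hstep i).rankLT hcomp (hreach i)⟩
  · intro S hS hend
    obtain ⟨G, rfl⟩ := hS.stateInv.exists_eq_halt hend
    exact ⟨G, rfl, hS.stateInv⟩
  · intro CPs SG PSyz cp hS hmin
    obtain ⟨f, A, -, hinv⟩ := hS.stateInv
    exact hinv.passesCriteria_iff hmin
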